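/- Let $H$ be a complex Hilbert space, $V\subseteq H$ a dense linear subspace, and let $A(t)$, $t\in T$, be a family of unbounded normal operators in $H$ (each $A(t)$ is closed and $A(t)A(t)^*=A(t)^*A(t)$) with common domain of definition $V$. The parameter domain $T$ and the class $C^M$ are one of the following. (i) $T$ is an open subset of a finite dimensional real vector space $E$ (for instance $E=T=\mathbb R^n$), and $C^M$ is one of: $C^\omega$ (real analytic); $C^\infty$; $C^{0,\alpha}$ with $0<\alpha\le 1$ (Hölder continuous of exponent $\alpha$ on each compact set); or the Denjoy–Carleman class of an increasing log-convex sequence $M=(M_k)_{k\ge 0}$ with $M_0=1$, i.e. the class of smooth $f$ such that for each compact $K$ there are $C,\rho>0$ with $\|D^kf(x)\|\le C\rho^k\,k!\,M_k$ for all $k\ge 0$ and $x\in K$. The sequence $M$ may be quasianalytic or non-quasianalytic, so all classes $C^Q$ ($Q$ quasianalytic, log-convex and an $\mathcal L$-intersection) and $C^L$ ($L$ non-quasianalytic and log-convex) are included. (ii) $T$ is a $c^\infty$-open subset of a convenient vector space $E$, and $C^M$ is $C^\infty$ or $C^{0,\alpha}$ with $0<\alpha\le1$, where a map is of class $C^M$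 if it is of class $C^M$ along each smooth curve in its domain. In this case all topological statements about $T$ and $T\times\mathbb C$ refer to the $c^\infty$-topologies of $E$ and $E\times\mathbb C$. Suppose that $t\mapsto\langle A(t)u,v\rangle$ is of class $C^M$ on $T$ for all $u\in V$ and $v\in H$. Let $$R=\{(t,z)\in T\times\mathbb C:\ A(t)-z:V\to H\text{ is invertible}\}$$ be the global resolvent set. Then: 1. For each $(t,z)\in R$ the inverse $(A(t)-z)^{-1}$ is a bounded operator on $H$, and $(t,z)\mapsto (A(t)-z)^{-1}\in L(H,H)$ is of class $C^M$ on $R$. 2. $R$ is open (in case (ii), both for the $c^\infty$-topology of $E\times\mathbb C$ and for the product of the $c^\infty$-topology of $E$ with the topology of $\mathbb C$). If $T$ is connected and each $A(t)$ has compact resolvent, then $R$ is connected. 3. The graph norms $\|u\|_t=(\|u\|^2+\|A(t)u\|^2)^{1/2}$, $t\in T$, on $V$ are equivalent, locally uniformly in $t$: for all $s,t_0\in T$ there are an open neighborhood $U\subseteq T$ of $t_0$ and $C>0$ with $\|u\|_t\le C\|u\|_s$ and $\|u\|_s\le C\|u\|_t$ for all $t\in U$ and $u\in V$. 4. For each $s\in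 T$, every $A(t)$ is bounded from $(V,\|\cdot\|_s)$ to $H$, and $t\mapsto A(t)\in L((V,\|\cdot\|_s),H)$ is of class $C^M$ on $T$. -/

import Mathlib

open Set Filter Topology
open scoped ContDiff

noncomputable section

namespace NormalFamily

/-! ## Differentiability classes -/

/-- A weight sequence: `M 0 = 1`, increasing, and log-convex. The sequence may be
quasianalytic or non-quasianalytic. -/
structure IsLogConvexWeight (M : ℕ → ℝ) : Prop where
  zero_eq_one : M 0 = 1
  mono : ∀ k, M k ≤ M (k + 1)
  logConvex : ∀ k, M (k + 1) ^ 2 ≤ M k * M (k + 2)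

/-- Names for the classes: real analytic, Denjoy-Carleman with weight sequence `M`,
smooth, and Hölder of exponent `α`. -/
inductive DiffClass : Type
  | analytic : DiffClass
  | denjoyCarleman (M : ℕ → ℝ) : DiffClass
  | smooth : DiffClass
  | holder (α : ℝ) : DiffClass

/-- The admissible classes: the weight sequence is log-convex, the Hölder exponent lies
in `(0, 1]`. -/
def DiffClass.Admissible : DiffClass → Prop
  | .analytic => True
  | .denjoyCarleman M => IsLogConvexWeight M
  | .smooth => True
  | .holder α => 0 < α ∧ α ≤ 1

/-- `κ.IsOn f U`: the map `f` is of class `κ` on `U`, for `U` an open subset of a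
finite dimensional real normed space. In the Denjoy-Carleman case the estimates are on the
norms of the iterated Fréchet derivatives; up to a change of `ρ` this is the same as the
estimates `‖∂^γ f x‖ ≤ C * ρ ^ |γ| * |γ|! * M |γ|` on the partial derivatives. -/
def DiffClass.IsOn {E F : Type*} [NormedAddCommGroup E] [NormedSpace ℝ E]
    [NormedAddCommGroup F] [NormedSpace ℝ F] (κ : DiffClass) (f : E → F) (U : Set E) : Prop :=
  match κ with
  | .analytic => AnalyticOnNhd ℝ f U
  | .denjoyCarleman M => ContDiffOn ℝ ∞ f U ∧ ∀ K ⊆ U, IsCompact K →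
      ∃ C > 0, ∃ ρ > 0, ∀ k : ℕ, ∀ x ∈ K,
        ‖iteratedFDeriv ℝ k f x‖ ≤ C * ρ ^ k * (Nat.factorial k : ℝ) * M k
  | .smooth => ContDiffOn ℝ ∞ f U
  | .holder α => ∀ K ⊆ U, IsCompact K →
      ∃ C > 0, ∀ x ∈ K, ∀ y ∈ K, ‖f x - f y‖ ≤ C * ‖x - y‖ ^ α

/-! ## Convenient calculus -/

section Convenient

variable {E : Type*} [AddCommGroup E] [Module ℝ E] [TopologicalSpace E]

/-- Smooth curves in a topological vector space: all iterated derivatives `D n`, defined as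
limits of difference quotients, exist. -/
def IsSmoothCurve (c : ℝ → E) : Prop :=
  ∃ D : ℕ → ℝ → E, D 0 = c ∧
    ∀ n s, Tendsto (fun r => (r - s)⁻¹ • (D n r - D n s)) (𝓝[≠] s) (𝓝 (D (n + 1) s))

variable (E) in
/-- Mackey completeness: every Mackey-Cauchy sequence converges. A Hausdorff locally convex
space is convenient iff it has this property. -/
def IsMackeyComplete : Prop :=
  ∀ x : ℕ → E,
    (∃ B : Set E, Bornology.IsVonNBounded ℝ B ∧ ∃ μ : ℕ × ℕ → ℝ, Tendsto μ atTop (𝓝 0) ∧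
      ∀ n m, ∃ b ∈ B, x n - x m = μ (n, m) • b) →
    ∃ l, Tendsto x atTop (𝓝 l)

variable (E) in
/-- The `c^∞`-topology: the final topology with respect to all smooth curves. -/
@[reducible] def cInftyTopology : TopologicalSpace E :=
  ⨆ c : {c : ℝ → E // IsSmoothCurve c}, TopologicalSpace.coinduced c.1 inferInstance

/-- `κ.IsAlongCurves f U`: along each smooth curve in `U`, the map `f` is of class `κ`. For
`κ` smooth or Hölder and `U` open for the `c^∞`-topology, this is the definition of maps of
class `κ` in convenient calculus. -/
def DiffClass.IsAlongCurves {F : Type*} [NormedAddCommGroup F] [NormedSpace ℝ F]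
    (κ : DiffClass) (f : E → F) (U : Set E) : Prop :=
  ∀ c : ℝ → E, IsSmoothCurve c → (∀ s, c s ∈ U) → κ.IsOn (fun s => f (c s)) univ

end Convenient

/-! ## Unbounded operators with domain `V`, their resolvents and their graph norms -/

section Operators

variable {H : Type*} [NormedAddCommGroup H] [InnerProductSpace ℂ H]
variable {V : Submodule ℂ H}

/-- A densely defined operator `B` with domain `V` is normal if it is closed and
`B B* = B* B`, as unbounded operators, including equality of domains. -/
structure IsNormalOp [CompleteSpace H] (B : V →ₗ[ℂ] H) : Prop where
  dense : Dense (V : Set H)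
  closed : (LinearPMap.mk V B).IsClosed
  comm : ∀ u w : H,
    (∃ v, (u, v) ∈ (LinearPMap.mk V B).graph ∧ (v, w) ∈ (LinearPMap.mk V B).adjoint.graph) ↔
    (∃ v, (u, v) ∈ (LinearPMap.mk V B).adjoint.graph ∧ (v, w) ∈ (LinearPMap.mk V B).graph)

/-- `z` is in the resolvent set of `B` if `B - z : V → H` is invertible. -/
def InResolventSet (B : V →ₗ[ℂ] H) (z : ℂ) : Prop :=
  Function.Bijective (fun u : V => B u - z • (u : H))

/-- The bounded operator `R` on `H` is the inverse of `B - z : V → H`. -/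
def IsResolventAt (B : V →ₗ[ℂ] H) (z : ℂ) (R : H →L[ℂ] H) : Prop :=
  (∀ u : V, R (B u - z • (u : H)) = u) ∧
    ∀ x : H, ∃ u : V, (u : H) = R x ∧ B u - z • (u : H) = x

open Classical in
/-- The resolvent `(B - z)⁻¹`, as a bounded operator on `H` (and `0` if there is none). -/
def resolventOp (B : V →ₗ[ℂ] H) (z : ℂ) : H →L[ℂ] H :=
  if h : ∃ R : H →L[ℂ] H, IsResolventAt B z R then h.choose else 0

/-- `B` has compact resolvent. -/
def HasCompactResolvent (B : V →ₗ[ℂ] H) : Prop :=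
  ∃ z : ℂ, InResolventSet B z ∧ IsCompactOperator (resolventOp B z)

/-- The global resolvent set of the family `A t`, `t ∈ T`. -/
def globalResolventSet {E : Type*} (T : Set E) (A : E → V →ₗ[ℂ] H) : Set (E × ℂ) :=
  {p | p.1 ∈ T ∧ InResolventSet (A p.1) p.2}

/-- The graph norm of `B` on `V`. -/
def graphNorm (B : V →ₗ[ℂ] H) (u : V) : ℝ := √(‖(u : H)‖ ^ 2 + ‖B u‖ ^ 2)

/-- The space `V`, to be equipped with the graph norm of `B`. -/
def GraphSpace (_B : V →ₗ[ℂ] H) : Type _ := V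

namespace GraphSpace

variable (B : V →ₗ[ℂ] H)

instance : AddCommGroup (GraphSpace B) := inferInstanceAs (AddCommGroup V)

instance : Module ℂ (GraphSpace B) := inferInstanceAs (Module ℂ V)

/-- The identity `V → GraphSpace B`. -/
def of : V ≃ₗ[ℂ] GraphSpace B := LinearEquiv.refl ℂ V

/-- The embedding of `V` onto the graph of `B`. -/
def toGraph : GraphSpace B →ₗ[ℂ] WithLp 2 (H × H) :=
  (WithLp.linearEquiv 2 ℂ (H × H)).symm.toLinearMap ∘ₗ
    (V.subtype.prod B) ∘ₗ (of B).symm.toLinearMap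

theorem toGraph_injective : Function.Injective (toGraph B) := by
  intro u v h
  have h1 := congrArg (fun x : WithLp 2 (H × H) => x.fst) h
  exact Subtype.ext h1

instance : NormedAddCommGroup (GraphSpace B) :=
  NormedAddCommGroup.induced (GraphSpace B) (WithLp 2 (H × H)) (toGraph B) (toGraph_injective B)

instance : NormedSpace ℂ (GraphSpace B) :=
  NormedSpace.induced ℂ (GraphSpace B) (WithLp 2 (H × H)) (toGraph B)

theorem norm_of (u : V) : ‖of B u‖ = graphNorm B u := by
  have h : ‖of B u‖ = ‖toGraph B (of B u)‖ := rfl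
  rw [h, WithLp.prod_norm_eq_of_L2]
  rfl

end GraphSpace

end Operators

end NormalFamily

end

/-! Fix `s`. Since `A s` is closed, `V` with its graph norm is a Banach space, and the closed graph
theorem makes every `A t` bounded from it to `H` (`toCLM_apply`). The unbounded family becomes a map
into one Banach space of operators, of which only the matrix coefficients are known to be of class
`κ`.

The passage from weak to strong (`IsNorming.isOn`) rests on a Baire argument, `exists_growth_bound`:
if `‖T x‖ ≤ C ρ^k` on `S k`, with `C` and `ρ` depending on `x`, then such a bound holds for the
operator norms. It applies to suitably weighted difference quotients, Taylor remainders and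
derivatives, so each class is detected by the functionals `T ↦ ⟪v, T u⟫`.

The resolvent is the inverse of `toCLM - z • incl` followed by the inclusion of the graph space.
Invertible operators form an open set, which gives openness, and `isOn_inverse` shows that inversion
preserves each class; the Denjoy-Carleman case uses `M j * M k ≤ M (j + k)`. Norm continuity of `t ↦
A t` yields the local equivalence of graph norms.

For compact resolvents every fibre is the complement of a countable set in the plane, hence
connected. A continuous two-valued function on the open resolvent set is then constant on fibres and
descends to a continuous function on `T` (`isConnected_of_fibers`).

In the convenient setting all class statements are tested along smooth curves, which reduces them to
one real parameter; `continuousOn_cInfty` recovers continuity for the `c^∞`-topology. -/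

noncomputable section

namespace NormalFamily

/-! ## Weight sequences -/

namespace IsLogConvexWeight

variable {M : ℕ → ℝ} (hM : IsLogConvexWeight M)
include hM

theorem one_le (k : ℕ) : 1 ≤ M k := by
  have h := monotone_nat_of_le_succ hM.mono (Nat.zero_le k)
  rwa [hM.zero_eq_one] at h

theorem pos (k : ℕ) : 0 < M k := zero_lt_one.trans_le (hM.one_le k)

/-- Log-convexity makes the ratios `M (i + 1) / M i` increase with `i`; this is the comparison of
two ratios with denominators cleared. -/
theorem succ_mul_le (j k : ℕ) : M (j + 1) * M (j + k) ≤ M j * M (j + k + 1) := by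
  induction k with
  | zero => exact (mul_comm _ _).le
  | succ k ih =>
    have h1 := hM.logConvex (j + k)
    have p1 := hM.pos (j + k)
    have p2 := hM.pos (j + k + 1)
    have p3 := hM.pos j
    have h2 : M (j + 1) * M (j + k + 1) ^ 2 ≤ M j * M (j + k + 1) * M (j + k + 2) := by
      calc M (j + 1) * M (j + k + 1) ^ 2 ≤ M (j + 1) * (M (j + k) * M (j + k + 2)) :=
            mul_le_mul_of_nonneg_left h1 (hM.pos _).le
        _ = (M (j + 1) * M (j + k)) * M (j + k + 2) := by ring
        _ ≤ M j * M (j + k + 1) * M (j + k + 2) :=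
            mul_le_mul_of_nonneg_right ih (hM.pos _).le
    refine le_of_mul_le_mul_right (a := M (j + k + 1)) ?_ p2
    calc M (j + 1) * M (j + (k + 1)) * M (j + k + 1) = M (j + 1) * M (j + k + 1) ^ 2 := by
          rw [← add_assoc]; ring
      _ ≤ _ := h2
      _ = _ := by rw [← add_assoc]; ring

/-- Raising `j` by one multiplies the left side by the ratio at `j` and the right side by the larger
ratio at `j + k`. The inversion estimate uses log-convexity in this form. -/
theorem mul_le_add (j k : ℕ) : M j * M k ≤ M (j + k) := by
  induction j with
  | zero => simp [hM.zero_eq_one]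
  | succ j ih =>
    refine le_of_mul_le_mul_left (a := M j) ?_ (hM.pos j)
    calc M j * (M (j + 1) * M k) = M (j + 1) * (M j * M k) := by ring
      _ ≤ M (j + 1) * M (j + k) := mul_le_mul_of_nonneg_left ih (hM.pos _).le
      _ ≤ M j * M (j + k + 1) := hM.succ_mul_le j k
      _ = _ := by rw [show j + 1 + k = j + k + 1 by omega]

end IsLogConvexWeight

theorem le_mul_rpow_of_le {d D α : ℝ} (hd : 0 ≤ d) (hD : d ≤ D) (h0 : 0 < α) (h1 : α ≤ 1) :
    d ≤ max D 1 * d ^ α := by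
  rcases le_total d 1 with h | h
  · rcases hd.eq_or_lt with rfl | hd'
    · simp [Real.zero_rpow h0.ne']
    · have := Real.rpow_le_rpow_of_exponent_ge hd' h h1
      rw [Real.rpow_one] at this
      nlinarith [le_max_right D 1, Real.rpow_nonneg hd α]
  · have := Real.one_le_rpow h h0.le
    nlinarith [le_max_left D 1, le_max_right D 1]

/-! ## Closure properties of the classes -/

namespace DiffClass

variable {E E' F G : Type*} [NormedAddCommGroup E] [NormedSpace ℝ E]
  [NormedAddCommGroup E'] [NormedSpace ℝ E'] [NormedAddCommGroup F] [NormedSpace ℝ F]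
  [NormedAddCommGroup G] [NormedSpace ℝ G] {κ : DiffClass} {f g : E → F} {U U' : Set E}

theorem IsOn.mono (h : κ.IsOn f U) (hU : U' ⊆ U) : κ.IsOn f U' := by
  cases κ with
  | analytic => exact AnalyticOnNhd.mono h hU
  | denjoyCarleman M => exact ⟨h.1.mono hU, fun K hK => h.2 K (hK.trans hU)⟩
  | smooth => exact ContDiffOn.mono h hU
  | holder α => exact fun K hK => h K (hK.trans hU)

theorem IsOn.congr (h : κ.IsOn f U) (hU : IsOpen U) (hfg : EqOn f g U) : κ.IsOn g U := by
  cases κ with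
  | analytic => exact AnalyticOnNhd.congr hU h hfg
  | denjoyCarleman M =>
    refine ⟨h.1.congr hfg.symm, fun K hK hKc => ?_⟩
    obtain ⟨C, hC, ρ, hρ, H⟩ := h.2 K hK hKc
    refine ⟨C, hC, ρ, hρ, fun k x hx => ?_⟩
    have : g =ᶠ[𝓝 x] f := (hfg.eventuallyEq_of_mem (hU.mem_nhds (hK hx))).symm
    rw [(this.iteratedFDeriv ℝ k).eq_of_nhds]
    exact H k x hx
  | smooth => exact ContDiffOn.congr h hfg.symm
  | holder α =>
    intro K hK hKc
    obtain ⟨C, hC, H⟩ := h K hK hKc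
    refine ⟨C, hC, fun x hx y hy => ?_⟩
    rw [← hfg (hK hx), ← hfg (hK hy)]
    exact H x hx y hy

theorem IsOn.clm_comp (h : κ.IsOn f U) (hU : IsOpen U) (L : F →L[ℝ] G) :
    κ.IsOn (fun x => L (f x)) U := by
  cases κ with
  | analytic => exact fun x hx => L.analyticAt _ |>.comp (h x hx)
  | denjoyCarleman M =>
    refine ⟨L.contDiff.comp_contDiffOn h.1, fun K hK hKc => ?_⟩
    obtain ⟨C, hC, ρ, hρ, H⟩ := h.2 K hK hKc
    refine ⟨(‖L‖ + 1) * C, by positivity, ρ, hρ, fun k x hx => ?_⟩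
    have hd : ContDiffAt ℝ ∞ f x := h.1.contDiffAt (hU.mem_nhds (hK hx))
    have h1 := L.norm_iteratedFDeriv_comp_left hd (n := k) (by exact_mod_cast le_top)
    refine (h1.trans (mul_le_mul (by linarith : ‖L‖ ≤ ‖L‖ + 1) (H k x hx) (norm_nonneg _)
      (by positivity))).trans_eq (by ring)
  | smooth => exact L.contDiff.comp_contDiffOn h
  | holder α =>
    intro K hK hKc
    obtain ⟨C, hC, H⟩ := h K hK hKc
    refine ⟨(‖L‖ + 1) * C, by positivity, fun x hx y hy => ?_⟩
    rw [← map_sub, mul_assoc]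
    exact (L.le_opNorm _).trans (mul_le_mul (by linarith) (H x hx y hy) (norm_nonneg _)
      (by positivity))

theorem IsOn.add (hκ : κ.Admissible) (hU : IsOpen U) (hf : κ.IsOn f U) (hg : κ.IsOn g U) :
    κ.IsOn (fun x => f x + g x) U := by
  cases κ with
  | analytic => exact fun x hx => (hf x hx).add (hg x hx)
  | denjoyCarleman M =>
    refine ⟨hf.1.add hg.1, fun K hK hKc => ?_⟩
    obtain ⟨C, hC, ρ, hρ, H⟩ := hf.2 K hK hKc
    obtain ⟨C', hC', ρ', hρ', H'⟩ := hg.2 K hK hKc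
    refine ⟨C + C', by positivity, max ρ ρ', by positivity, fun k x hx => ?_⟩
    have hd : ContDiffAt ℝ ∞ f x := hf.1.contDiffAt (hU.mem_nhds (hK hx))
    have hd' : ContDiffAt ℝ ∞ g x := hg.1.contDiffAt (hU.mem_nhds (hK hx))
    have e := iteratedFDeriv_add_apply (i := k) (hd.of_le (by exact_mod_cast le_top))
      (hd'.of_le (by exact_mod_cast le_top))
    have e' : iteratedFDeriv ℝ k (fun x => f x + g x) x =
      iteratedFDeriv ℝ k f x + iteratedFDeriv ℝ k g x := e
    rw [e']
    have hMk := (IsLogConvexWeight.pos hκ k).le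
    calc _ ≤ _ := norm_add_le _ _
      _ ≤ C * ρ ^ k * (Nat.factorial k : ℝ) * M k + C' * ρ' ^ k * (Nat.factorial k : ℝ) * M k :=
          add_le_add (H k x hx) (H' k x hx)
      _ ≤ C * max ρ ρ' ^ k * (Nat.factorial k : ℝ) * M k
          + C' * max ρ ρ' ^ k * (Nat.factorial k : ℝ) * M k := by
        gcongr
        · exact le_max_left _ _
        · exact le_max_right _ _
      _ = _ := by ring
  | smooth => exact ContDiffOn.add hf hg
  | holder α =>
    intro K hK hKc
    obtain ⟨C, hC, H⟩ := hf K hK hKc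
    obtain ⟨C', hC', H'⟩ := hg K hK hKc
    refine ⟨C + C', by positivity, fun x hx y hy => ?_⟩
    calc ‖f x + g x - (f y + g y)‖ = ‖(f x - f y) + (g x - g y)‖ := by congr 1; abel
      _ ≤ _ := norm_add_le _ _
      _ ≤ _ := add_le_add (H x hx y hy) (H' x hx y hy)
      _ = _ := by ring

theorem IsOn.comp_clm (hκ : κ.Admissible) (hU : IsOpen U) (hf : κ.IsOn f U) (L : E' →L[ℝ] E) :
    κ.IsOn (fun x => f (L x)) (L ⁻¹' U) := by
  cases κ with
  | analytic => exact fun x hx => AnalyticAt.comp (hf _ hx) (L.analyticAt x)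
  | denjoyCarleman M =>
    refine ⟨hf.1.comp L.contDiff.contDiffOn (fun x hx => hx), fun K hK hKc => ?_⟩
    obtain ⟨C, hC, ρ, hρ, H⟩ := hf.2 (L '' K) (image_subset_iff.2 hK) (hKc.image L.continuous)
    refine ⟨C, hC, ρ * (‖L‖ + 1), by positivity, fun k x hx => ?_⟩
    have hU' : IsOpen (L ⁻¹' U) := hU.preimage L.continuous
    have e := L.iteratedFDerivWithin_comp_right hf.1 hU.uniqueDiffOn hU'.uniqueDiffOn
      (x := x) (hK hx) (i := k) (by exact_mod_cast le_top)
    rw [iteratedFDerivWithin_of_isOpen k hU' (hK hx),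
      iteratedFDerivWithin_of_isOpen k hU (hK hx)] at e
    have e' : iteratedFDeriv ℝ k (fun x => f (L x)) x = _ := e
    rw [e']
    have hMk := (IsLogConvexWeight.pos hκ k).le
    calc _ ≤ _ := ContinuousMultilinearMap.norm_compContinuousLinearMap_le _ _
      _ = ‖iteratedFDeriv ℝ k f (L x)‖ * ‖L‖ ^ k := by simp
      _ ≤ (C * ρ ^ k * (Nat.factorial k : ℝ) * M k) * (‖L‖ + 1) ^ k := by
        refine mul_le_mul (H k _ (mem_image_of_mem _ hx)) ?_ (by positivity) (by positivity)
        gcongr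
        linarith
      _ = _ := by rw [mul_pow]; ring
  | smooth => exact ContDiffOn.comp hf L.contDiff.contDiffOn (fun x hx => hx)
  | holder α =>
    intro K hK hKc
    obtain ⟨C, hC, H⟩ := hf (L '' K) (image_subset_iff.2 hK) (hKc.image L.continuous)
    refine ⟨C * (‖L‖ + 1) ^ α, by positivity, fun x hx y hy => ?_⟩
    refine (H _ (mem_image_of_mem _ hx) _ (mem_image_of_mem _ hy)).trans ?_
    rw [mul_assoc, ← Real.mul_rpow (by positivity) (norm_nonneg _), ← map_sub]
    refine mul_le_mul_of_nonneg_left (Real.rpow_le_rpow (norm_nonneg _) ?_ hκ.1.le) hC.le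
    exact (L.le_opNorm _).trans (mul_le_mul_of_nonneg_right (by linarith) (norm_nonneg _))

theorem isOn_holder_of_lipschitz {α : ℝ} (hκ : (holder α).Admissible)
    (h : ∀ K ⊆ U, IsCompact K → ∃ C, ∀ x ∈ K, ∀ y ∈ K, ‖f x - f y‖ ≤ C * ‖x - y‖) :
    (holder α).IsOn f U := by
  intro K hK hKc
  obtain ⟨C, H⟩ := h K hK hKc
  refine ⟨(|C| + 1) * max (Metric.diam K) 1, by positivity, fun x hx y hy => ?_⟩
  have hd : ‖x - y‖ ≤ Metric.diam K := by
    rw [← dist_eq_norm]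
    exact Metric.dist_le_diam_of_mem hKc.isBounded hx hy
  calc ‖f x - f y‖ ≤ C * ‖x - y‖ := H x hx y hy
    _ ≤ (|C| + 1) * ‖x - y‖ :=
      mul_le_mul_of_nonneg_right (by linarith [le_abs_self C]) (norm_nonneg _)
    _ ≤ (|C| + 1) * (max (Metric.diam K) 1 * ‖x - y‖ ^ α) :=
      mul_le_mul_of_nonneg_left (le_mul_rpow_of_le (norm_nonneg _) hd hκ.1 hκ.2) (by positivity)
    _ = _ := by ring

theorem isOn_clm (hκ : κ.Admissible) (L : E →L[ℝ] F) (U : Set E) : κ.IsOn L U := by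
  cases κ with
  | analytic => exact fun x _ => L.analyticAt x
  | denjoyCarleman M =>
    refine ⟨L.contDiff.contDiffOn, fun K hK hKc => ?_⟩
    obtain ⟨D, hD⟩ := (hKc.image L.continuous).isBounded.exists_norm_le
    have hM : IsLogConvexWeight M := hκ
    -- Only orders 0 and 1 contribute, bounded by `D` and `‖L‖`; the radius 1 suffices because `k! *
    -- M k ≥ 1`.
    refine ⟨|D| + ‖L‖ + 1, by positivity, 1, one_pos, fun k x hx => ?_⟩
    have h1 : |D| + ‖L‖ + 1 ≤ (|D| + ‖L‖ + 1) * 1 ^ k * (Nat.factorial k : ℝ) * M k := by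
      rw [one_pow, mul_one, mul_assoc]
      have : (1 : ℝ) ≤ Nat.factorial k := by exact_mod_cast Nat.succ_le_of_lt k.factorial_pos
      exact le_mul_of_one_le_right (by positivity) (one_le_mul_of_one_le_of_one_le this (hM.one_le k))
    refine le_trans ?_ h1
    match k with
    | 0 =>
      rw [norm_iteratedFDeriv_zero]
      have := hD _ (mem_image_of_mem _ hx)
      linarith [le_abs_self D, norm_nonneg L]
    | 1 =>
      rw [norm_iteratedFDeriv_one, L.fderiv]
      linarith [abs_nonneg D]
    | k + 2 =>
      have e : iteratedFDeriv ℝ (k + 2) L x = 0 := by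
        have e1 : fderiv ℝ (L : E → F) = fun _ => L := by ext1 x; exact L.fderiv
        ext v
        rw [iteratedFDeriv_succ_apply_right, e1]
        simp [iteratedFDeriv_const_of_ne]
      rw [e, norm_zero]
      positivity
  | smooth => exact L.contDiff.contDiffOn
  | holder α =>
    refine isOn_holder_of_lipschitz hκ fun K _ _ => ⟨‖L‖, fun x _ y _ => ?_⟩
    rw [← map_sub]
    exact L.le_opNorm _

theorem IsOn.continuousOn [LocallyCompactSpace E] (hκ : κ.Admissible) (hU : IsOpen U)
    (hf : κ.IsOn f U) : ContinuousOn f U := by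
  cases κ with
  | analytic => exact AnalyticOnNhd.continuousOn hf
  | denjoyCarleman M => exact hf.1.continuousOn
  | smooth => exact ContDiffOn.continuousOn hf
  | holder α =>
    intro x hx
    obtain ⟨K, hKx, hKU, hKc⟩ := local_compact_nhds (hU.mem_nhds hx)
    obtain ⟨C, hC, H⟩ := hf K hKU hKc
    refine ContinuousAt.continuousWithinAt (tendsto_iff_norm_sub_tendsto_zero.2 ?_)
    have h1 : Tendsto (fun y => C * ‖y - x‖ ^ α) (𝓝 x) (𝓝 0) := by
      have : ContinuousAt (fun y => C * ‖y - x‖ ^ α) x := by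
        refine continuousAt_const.mul (ContinuousAt.rpow_const (by fun_prop) (Or.inr hκ.1.le))
      have h2 := this.tendsto
      simpa [Real.zero_rpow hκ.1.ne'] using h2
    refine squeeze_zero' (Eventually.of_forall fun _ => norm_nonneg _) ?_ h1
    filter_upwards [hKx] with y hy using H y hy x (mem_of_mem_nhds hKx)

end DiffClass

/-! ## Uniform boundedness with growth -/

/-- Banach-Steinhaus with two pointwise constants. Letting one integer `n` play both roles gives
countably many closed sets covering `X`, so by Baire one of them contains a ball. -/
theorem exists_growth_bound {X Y : Type*} [NormedAddCommGroup X] [NormedSpace ℂ X]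
    [CompleteSpace X] [NormedAddCommGroup Y] [NormedSpace ℂ Y] (S : ℕ → Set (X →L[ℂ] Y))
    (h : ∀ x, ∃ C ρ : ℝ, ∀ k, ∀ T ∈ S k, ‖T x‖ ≤ C * ρ ^ k) :
    ∃ C > 0, ∃ ρ > 0, ∀ k, ∀ T ∈ S k, ‖T‖ ≤ C * ρ ^ k := by
  let F : ℕ → Set X := fun n => {x | ∀ k, ∀ T ∈ S k, ‖T x‖ ≤ n * (n : ℝ) ^ k}
  have hF : ∀ n, IsClosed (F n) := by
    intro n
    have : F n = ⋂ k, ⋂ T ∈ S k, {x | ‖T x‖ ≤ n * (n : ℝ) ^ k} := by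
      ext x; simp [F]
    rw [this]
    refine isClosed_iInter fun k => isClosed_iInter fun T => isClosed_iInter fun _ => ?_
    exact isClosed_le (by fun_prop) continuous_const
  have hU : ⋃ n, F n = univ := by
    refine eq_univ_of_forall fun x => ?_
    obtain ⟨C, ρ, H⟩ := h x
    obtain ⟨n, hn⟩ := exists_nat_ge (max |C| |ρ|)
    refine mem_iUnion.2 ⟨n, fun k T hT => (H k T hT).trans ?_⟩
    calc C * ρ ^ k ≤ |C * ρ ^ k| := le_abs_self _
      _ = |C| * |ρ| ^ k := by rw [abs_mul, abs_pow]
      _ ≤ n * (n : ℝ) ^ k := by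
        have h1 := (le_max_left _ _).trans hn
        have h2 := (le_max_right _ _).trans hn
        gcongr
  obtain ⟨n, x₀, hx₀⟩ := nonempty_interior_of_iUnion_of_closed hF hU
  obtain ⟨r, hr, hball⟩ := Metric.isOpen_iff.1 isOpen_interior x₀ hx₀
  have hball' : Metric.ball x₀ r ⊆ F n := hball.trans interior_subset
  -- Subtracting the value at the centre bounds `T` by `2 * n * n ^ k` on vectors of norm `r / 2`;
  -- `n + 1` replaces `n` to keep both constants positive.
  refine ⟨2 * (n + 1) / (r / 2), by positivity, n + 1, by positivity, fun k T hT => ?_⟩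
  refine T.opNorm_le_bound (by positivity) fun x => ?_
  rcases eq_or_ne x 0 with rfl | hx
  · simp
  have hxn : 0 < ‖x‖ := norm_pos_iff.2 hx
  set c : ℂ := ((r / 2 / ‖x‖ : ℝ) : ℂ)
  have hc : ‖c‖ = r / 2 / ‖x‖ := by
    rw [Complex.norm_real, Real.norm_of_nonneg (by positivity)]
  have hcx : ‖c • x‖ = r / 2 := by rw [norm_smul, hc]; field_simp
  have h1 : ‖T (x₀ + c • x)‖ ≤ n * (n : ℝ) ^ k := by
    refine hball' ?_ k T hT
    rw [mem_ball_iff_norm, add_sub_cancel_left, hcx]; linarith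
  have h2 : ‖T x₀‖ ≤ n * (n : ℝ) ^ k := hball' (Metric.mem_ball_self hr) k T hT
  have h3 : ‖T (c • x)‖ ≤ 2 * (n * (n : ℝ) ^ k) := by
    have : T (c • x) = T (x₀ + c • x) - T x₀ := by rw [map_add]; abel
    rw [this]
    linarith [norm_sub_le (T (x₀ + c • x)) (T x₀)]
  rw [map_smul, norm_smul, hc] at h3
  have h4 : (n : ℝ) * (n : ℝ) ^ k ≤ (n + 1) * (n + 1 : ℝ) ^ k := by gcongr <;> linarith
  have h5 : ‖T x‖ = (r / 2 / ‖x‖ * ‖T x‖) / (r / 2) * ‖x‖ := by field_simp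
  rw [h5]
  refine mul_le_mul_of_nonneg_right ?_ hxn.le
  rw [div_mul_eq_mul_div (2 * ((n : ℝ) + 1))]
  refine div_le_div_of_nonneg_right ?_ (half_pos hr).le
  linarith

/-! ## Norming families of functionals -/

section Norming

variable {ι E F G : Type*} [NormedAddCommGroup E] [NormedSpace ℝ E]
  [NormedAddCommGroup F] [NormedSpace ℝ F] [NormedAddCommGroup G] [NormedSpace ℝ G]

/-- A family of maps detects boundedness: a sequence of sets is of at most geometric growth
if it is so under each map of the family. -/
def IsNorming (Λ : ι → G →L[ℝ] F) : Prop :=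
  ∀ S : ℕ → Set G, (∀ i, ∃ C ρ : ℝ, ∀ k, ∀ g ∈ S k, ‖Λ i g‖ ≤ C * ρ ^ k) →
    ∃ C > 0, ∃ ρ > 0, ∀ k, ∀ g ∈ S k, ‖g‖ ≤ C * ρ ^ k

/-- The functionals `T ↦ ⟪v, T u⟫` on the bounded operators. -/
def innerFunctional {W H : Type*} [NormedAddCommGroup W] [NormedSpace ℂ W]
    [NormedAddCommGroup H] [InnerProductSpace ℂ H] (p : W × H) : (W →L[ℂ] H) →L[ℝ] ℂ :=
  ((innerSL ℂ p.2).comp (ContinuousLinearMap.apply ℂ H p.1)).restrictScalars ℝ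

theorem innerFunctional_apply {W H : Type*} [NormedAddCommGroup W] [NormedSpace ℂ W]
    [NormedAddCommGroup H] [InnerProductSpace ℂ H] (p : W × H) (T : W →L[ℂ] H) :
    innerFunctional p T = inner ℂ p.2 (T p.1) := rfl

/-- The growth bound is used twice: for fixed `u` on the functionals `⟪T u, ·⟫` on `H`, then on the
operators `T` themselves. -/
theorem isNorming_innerFunctional {W H : Type*} [NormedAddCommGroup W] [NormedSpace ℂ W]
    [CompleteSpace W] [NormedAddCommGroup H] [InnerProductSpace ℂ H] [CompleteSpace H] :
    IsNorming (innerFunctional : W × H → (W →L[ℂ] H) →L[ℝ] ℂ) := by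
  intro S h
  refine exists_growth_bound S fun u => ?_
  have key : ∃ C > 0, ∃ ρ > 0, ∀ k : ℕ, ∀ φ ∈ (fun T : W →L[ℂ] H => innerSL ℂ (T u)) '' S k,
      ‖φ‖ ≤ C * ρ ^ k := by
    refine exists_growth_bound _ fun v => ?_
    obtain ⟨C, ρ, H⟩ := h (u, v)
    refine ⟨C, ρ, fun k φ hφ => ?_⟩
    obtain ⟨T, hT, rfl⟩ := hφ
    rw [innerSL_apply_apply, norm_inner_symm]
    exact H k T hT
  obtain ⟨C, _, ρ, _, H⟩ := key
  refine ⟨C, ρ, fun k T hT => ?_⟩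
  have := H k _ (mem_image_of_mem _ hT)
  rwa [innerSL_apply_norm] at this

theorem map_iteratedFDeriv {f : E → G} {x : E} (L : G →L[ℝ] F) (hf : ContDiffAt ℝ ∞ f x) (k : ℕ)
    (v : Fin k → E) :
    L (iteratedFDeriv ℝ k f x v) = iteratedFDeriv ℝ k (fun x => L (f x)) x v := by
  have e := L.iteratedFDeriv_comp_left hf (i := k) (by exact_mod_cast le_top)
  have e' : iteratedFDeriv ℝ k (fun x => L (f x)) x = _ := e
  rw [e']
  rfl

namespace IsNorming

variable {Λ : ι → G →L[ℝ] F} (hΛ : IsNorming Λ) {f : E → G} {U : Set E}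
include hΛ

theorem exists_bound {S : Set G} (h : ∀ i, ∃ C : ℝ, ∀ g ∈ S, ‖Λ i g‖ ≤ C) :
    ∃ C > 0, ∀ g ∈ S, ‖g‖ ≤ C := by
  obtain ⟨C, hC, ρ, _, H⟩ := hΛ (fun _ => S) fun i => by
    obtain ⟨C, hC⟩ := h i
    exact ⟨C, 1, fun k g hg => by simpa using hC g hg⟩
  exact ⟨C, hC, fun g hg => by simpa using H 0 g hg⟩

/-- Otherwise the multiples of `g - g'` would be killed by every functional and yet be unbounded in
norm. -/
theorem ext {g g' : G} (h : ∀ i, Λ i g = Λ i g') : g = g' := by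
  by_contra hne
  have hpos : 0 < ‖g - g'‖ := norm_pos_iff.2 (sub_ne_zero.2 hne)
  obtain ⟨C, hC, H⟩ := hΛ.exists_bound (S := range fun n : ℕ => (n : ℝ) • (g - g')) fun i => by
    refine ⟨0, ?_⟩
    rintro _ ⟨n, rfl⟩
    simp [h i]
  obtain ⟨n, hn⟩ := exists_nat_gt (C / ‖g - g'‖)
  have := H _ (mem_range_self n)
  rw [norm_smul, Real.norm_natCast] at this
  rw [div_lt_iff₀ hpos] at hn
  linarith

omit hΛ in
theorem _root_.NormalFamily.exists_taylor_bound [ProperSpace E] {h : E → F} {x₀ : E} {r : ℝ}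
    (hU : IsOpen U) (hr : Metric.closedBall x₀ r ⊆ U) (hh : ContDiffOn ℝ 2 h U) :
    ∃ C : ℝ, 0 ≤ C ∧ ∀ x ∈ Metric.closedBall x₀ r,
      ‖h x - h x₀ - fderiv ℝ h x₀ (x - x₀)‖ ≤ C * ‖x - x₀‖ ^ 2 := by
  have h1 : ContDiffOn ℝ 1 (fderiv ℝ h) U := hh.fderiv_of_isOpen hU (by norm_num)
  have h2 : ContinuousOn (fderiv ℝ (fderiv ℝ h)) U :=
    h1.continuousOn_fderiv_of_isOpen hU le_rfl
  obtain ⟨C, hC⟩ := (isCompact_closedBall x₀ r).exists_bound_of_continuousOn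
    (f := fderiv ℝ (fderiv ℝ h)) (h2.mono hr)
  refine ⟨|C|, abs_nonneg C, fun x hx => ?_⟩
  have hr0 : ‖x - x₀‖ ≤ r := by rwa [mem_closedBall_iff_norm] at hx
  -- The mean value inequality is applied twice on the ball of radius `‖x - x₀‖`, first to the
  -- derivative and then to the map; each use contributes one factor `‖x - x₀‖`.
  have hsub : Metric.closedBall x₀ ‖x - x₀‖ ⊆ Metric.closedBall x₀ r :=
    Metric.closedBall_subset_closedBall hr0
  have hx₀ : x₀ ∈ Metric.closedBall x₀ ‖x - x₀‖ := Metric.mem_closedBall_self (norm_nonneg _)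
  have hxx : x ∈ Metric.closedBall x₀ ‖x - x₀‖ := by rw [mem_closedBall_iff_norm]
  have b1 : ∀ y ∈ Metric.closedBall x₀ ‖x - x₀‖,
      ‖fderiv ℝ h y - fderiv ℝ h x₀‖ ≤ |C| * ‖x - x₀‖ := by
    intro y hy
    have := (convex_closedBall x₀ ‖x - x₀‖).norm_image_sub_le_of_norm_hasFDerivWithin_le
      (f := fderiv ℝ h) (f' := fderiv ℝ (fderiv ℝ h)) (C := |C|)
      (fun z hz => (((h1.differentiableOn one_ne_zero).differentiableAt
        (hU.mem_nhds (hr (hsub hz)))).hasFDerivAt).hasFDerivWithinAt)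
      (fun z hz => (hC z (hsub hz)).trans (le_abs_self C)) hx₀ hy
    refine this.trans (mul_le_mul_of_nonneg_left ?_ (abs_nonneg C))
    rwa [mem_closedBall_iff_norm] at hy
  have := (convex_closedBall x₀ ‖x - x₀‖).norm_image_sub_le_of_norm_hasFDerivWithin_le'
    (f := h) (f' := fderiv ℝ h) (φ := fderiv ℝ h x₀) (C := |C| * ‖x - x₀‖)
    (fun z hz => (((hh.differentiableOn two_ne_zero).differentiableAt
      (hU.mem_nhds (hr (hsub hz)))).hasFDerivAt).hasFDerivWithinAt) b1 hx₀ hxx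
  exact this.trans_eq (by ring)

/-- One more scalar derivative than needed gives quadratic Taylor remainders under each functional.
Weighted quantities are then weakly bounded, hence norm bounded, and this is a rate of convergence
in norm. -/
theorem exists_hasFDerivAt [CompleteSpace G] [FiniteDimensional ℝ E] {x₀ : E}
    (hU : IsOpen U) (hx₀ : x₀ ∈ U) (hf : ∀ i, ContDiffOn ℝ 2 (fun x => Λ i (f x)) U) :
    ∃ L : E →L[ℝ] G, HasFDerivAt f L x₀ := by
  have : ProperSpace E := FiniteDimensional.proper_real E
  obtain ⟨r, hr, hrU⟩ := Metric.nhds_basis_closedBall.mem_iff.1 (hU.mem_nhds hx₀)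
  choose C hC0 hC using fun i => exists_taylor_bound hU hrU (hf i)
  -- directional derivatives
  have hdir : ∀ e : E, ∃ g : G, ∀ i, Λ i g = fderiv ℝ (fun x => Λ i (f x)) x₀ e := by
    intro e
    -- This keeps `x₀ + s n • e` inside the closed ball where the Taylor bounds hold.
    set δ : ℝ := r / (‖e‖ + 1)
    have hδ : 0 < δ := by positivity
    set s : ℕ → ℝ := fun n => δ * (1 / ((n : ℝ) + 1))
    have hs : ∀ n, 0 < s n := fun n => by positivity
    have hs1 : ∀ n, s n ≤ δ := fun n => by
      refine mul_le_of_le_one_right hδ.le ?_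
      rw [div_le_one (by positivity)]
      linarith [Nat.cast_nonneg (α := ℝ) n]
    have hs0 : Tendsto s atTop (𝓝 0) := by
      simpa [s] using (tendsto_one_div_add_atTop_nhds_zero_nat (𝕜 := ℝ)).const_mul δ
    set q : ℕ → G := fun n => (s n)⁻¹ • (f (x₀ + s n • e) - f x₀)
    have hmem : ∀ n, x₀ + s n • e ∈ Metric.closedBall x₀ r := by
      intro n
      rw [mem_closedBall_iff_norm, add_sub_cancel_left, norm_smul, Real.norm_of_nonneg (hs n).le]
      calc s n * ‖e‖ ≤ δ * (‖e‖ + 1) :=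
            mul_le_mul (hs1 n) (by linarith) (norm_nonneg _) hδ.le
        _ = r := by simp only [δ]; field_simp
    have hq : ∀ i n, ‖Λ i (q n) - fderiv ℝ (fun x => Λ i (f x)) x₀ e‖
        ≤ C i * ‖e‖ ^ 2 * s n := by
      intro i n
      have h1 := hC i _ (hmem n)
      rw [add_sub_cancel_left, map_smul, norm_smul, Real.norm_of_nonneg (hs n).le, mul_pow] at h1
      have h2 : Λ i (q n) - fderiv ℝ (fun x => Λ i (f x)) x₀ e = (s n)⁻¹ •
          (Λ i (f (x₀ + s n • e)) - Λ i (f x₀) - s n • fderiv ℝ (fun x => Λ i (f x)) x₀ e) := by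
        rw [smul_sub, smul_smul, inv_mul_cancel₀ (hs n).ne', one_smul, map_smul, map_sub]
      rw [h2, norm_smul, norm_inv, Real.norm_of_nonneg (hs n).le]
      calc _ ≤ (s n)⁻¹ * (C i * (s n ^ 2 * ‖e‖ ^ 2)) :=
            mul_le_mul_of_nonneg_left h1 (inv_nonneg.2 (hs n).le)
        _ = _ := by have := (hs n).ne'; field_simp
    -- Each functional sees `q n` within a multiple of `s n` of its limit, so dividing `q n - q m`
    -- by `s n + s m` leaves a weakly bounded set. Its norm bound makes `q` Cauchy.
    obtain ⟨D, hD, HD⟩ := hΛ.exists_bound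
      (S := range fun p : ℕ × ℕ => (s p.1 + s p.2)⁻¹ • (q p.1 - q p.2)) fun i => by
        refine ⟨C i * ‖e‖ ^ 2, ?_⟩
        rintro _ ⟨⟨n, m⟩, rfl⟩
        have hnm : 0 < s n + s m := add_pos (hs n) (hs m)
        rw [map_smul, norm_smul, norm_inv, Real.norm_of_nonneg hnm.le, map_sub,
          inv_mul_le_iff₀ hnm]
        have := norm_sub_le (Λ i (q n) - fderiv ℝ (fun x => Λ i (f x)) x₀ e)
          (Λ i (q m) - fderiv ℝ (fun x => Λ i (f x)) x₀ e)
        rw [sub_sub_sub_cancel_right] at this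
        linarith [hq i n, hq i m]
    have hcau : CauchySeq q := by
      refine cauchySeq_of_le_tendsto_0' (fun n => D * (2 * s n)) (fun n m hnm => ?_) ?_
      · have hp : 0 < s n + s m := add_pos (hs n) (hs m)
        have h1 := HD _ (mem_range_self (n, m))
        simp only at h1
        rw [norm_smul, norm_inv, Real.norm_of_nonneg hp.le, inv_mul_le_iff₀ hp] at h1
        have h2 : s m ≤ s n := mul_le_mul_of_nonneg_left (Nat.one_div_le_one_div hnm) hδ.le
        rw [dist_eq_norm]
        nlinarith
      · simpa using (hs0.const_mul 2).const_mul D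
    obtain ⟨g, hg⟩ := cauchySeq_tendsto_of_complete hcau
    refine ⟨g, fun i => ?_⟩
    have t1 : Tendsto (fun n => Λ i (q n)) atTop (𝓝 (Λ i g)) :=
      ((Λ i).continuous.tendsto g).comp hg
    have t2 : Tendsto (fun n => Λ i (q n)) atTop
        (𝓝 (fderiv ℝ (fun x => Λ i (f x)) x₀ e)) := by
      refine tendsto_iff_norm_sub_tendsto_zero.2 (squeeze_zero (fun _ => norm_nonneg _) (hq i) ?_)
      simpa using hs0.const_mul (C i * ‖e‖ ^ 2)
    exact tendsto_nhds_unique t1 t2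
  choose g hg using hdir
  let L₀ : E →ₗ[ℝ] G :=
    { toFun := g
      map_add' := fun x y => hΛ.ext fun i => by simp [hg]
      map_smul' := fun c x => hΛ.ext fun i => by simp [hg] }
  let L : E →L[ℝ] G := LinearMap.toContinuousLinearMap L₀
  have hL : ∀ i e, Λ i (L e) = fderiv ℝ (fun x => Λ i (f x)) x₀ e := fun i e => hg e i
  refine ⟨L, ?_⟩
  -- The same device on the Taylor remainder, divided by `‖x - x₀‖ ^ 2`, turns directional
  -- derivatives into a Fréchet derivative.
  obtain ⟨D, hD, HD⟩ := hΛ.exists_bound (S := (fun x => (‖x - x₀‖ ^ 2)⁻¹ •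
      (f x - f x₀ - L (x - x₀))) '' Metric.closedBall x₀ r) fun i => by
    refine ⟨C i, ?_⟩
    rintro _ ⟨x, hx, rfl⟩
    rw [map_smul, norm_smul, norm_inv, Real.norm_of_nonneg (by positivity), map_sub, map_sub, hL]
    exact inv_mul_le_of_le_mul₀ (by positivity) (hC0 i) ((hC i x hx).trans_eq (mul_comm _ _))
  have hO : (fun x => f x - f x₀ - L (x - x₀)) =O[𝓝 x₀] fun x => ‖x - x₀‖ ^ 2 := by
    refine Asymptotics.IsBigO.of_bound D ?_
    filter_upwards [Metric.closedBall_mem_nhds x₀ hr] with x hx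
    rcases eq_or_ne x x₀ with rfl | hne
    · simp
    have h1 := HD _ (mem_image_of_mem _ hx)
    have hp : 0 < ‖x - x₀‖ ^ 2 := by
      have := norm_pos_iff.2 (sub_ne_zero.2 hne); positivity
    rw [norm_smul, norm_inv, Real.norm_of_nonneg hp.le, inv_mul_le_iff₀ hp] at h1
    rw [Real.norm_of_nonneg hp.le]
    linarith
  have h0 := hO.hasFDerivAt (𝕜 := ℝ) (by norm_num)
  have h1 : HasFDerivAt (fun x => f x₀ + L (x - x₀)) L x₀ :=
    (L.hasFDerivAt.comp x₀ ((hasFDerivAt_id x₀).sub_const x₀)).const_add (f x₀)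
  have h2 := h0.add h1
  rw [zero_add] at h2
  refine h2.congr_of_eventuallyEq (Eventually.of_forall fun x => ?_)
  simp

/-- The hypothesis passes to every directional derivative, because `Λ i` commutes with `fderiv`;
finite dimension lets directional derivatives control the full derivative. -/
theorem contDiffOn_nat [CompleteSpace G] [FiniteDimensional ℝ E] (hU : IsOpen U) (n : ℕ) :
    ∀ f : E → G, (∀ i, ContDiffOn ℝ ∞ (fun x => Λ i (f x)) U) → ContDiffOn ℝ n f U := by
  induction n with
  | zero =>
    intro f hf
    refine contDiffOn_zero.2 fun x hx => ?_
    obtain ⟨L, hL⟩ := hΛ.exists_hasFDerivAt hU hx fun i => (hf i).of_le ENat.LEInfty.out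
    exact hL.continuousAt.continuousWithinAt
  | succ n ih =>
    intro f hf
    have hd : ∀ x ∈ U, DifferentiableAt ℝ f x := fun x hx => by
      obtain ⟨L, hL⟩ := hΛ.exists_hasFDerivAt hU hx fun i =>
        (hf i).of_le ENat.LEInfty.out
      exact hL.differentiableAt
    have := (contDiffOn_succ_iff_fderiv_apply (𝕜 := ℝ) (n := (n : WithTop ℕ∞)) (f := f)
      hU.uniqueDiffOn).2 ⟨fun x hx => (hd x hx).differentiableWithinAt, by simp, fun y => ?_⟩
    · exact_mod_cast this
    have h1 : ContDiffOn ℝ n (fun x => fderiv ℝ f x y) U := by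
      refine ih _ fun i => ?_
      have h2 : ContDiffOn ℝ ∞ (fderiv ℝ (fun x => Λ i (f x))) U :=
        (hf i).fderiv_of_isOpen hU (by simp)
      refine (h2.clm_apply (contDiffOn_const (c := y))).congr fun x hx => ?_
      have : fderiv ℝ (fun x => Λ i (f x)) x = (Λ i).comp (fderiv ℝ f x) :=
        ((Λ i).hasFDerivAt.comp x (hd x hx).hasFDerivAt).fderiv
      rw [this]; rfl
    exact h1.congr fun x hx => by rw [fderivWithin_of_isOpen hU hx]

theorem contDiffOn [CompleteSpace G] [FiniteDimensional ℝ E] (hU : IsOpen U)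
    (hf : ∀ i, ContDiffOn ℝ ∞ (fun x => Λ i (f x)) U) : ContDiffOn ℝ ∞ f U :=
  contDiffOn_infty.2 fun n => hΛ.contDiffOn_nat hU n f hf

theorem exists_iteratedFDeriv_bound {K : Set E} (hU : IsOpen U) (hf : ContDiffOn ℝ ∞ f U)
    (hK : K ⊆ U) {w : ℕ → ℝ} (hw : ∀ k, 0 < w k)
    (h : ∀ i, ∃ C ρ : ℝ, 0 ≤ C ∧ 0 ≤ ρ ∧ ∀ k, ∀ x ∈ K,
      ‖iteratedFDeriv ℝ k (fun x => Λ i (f x)) x‖ ≤ C * ρ ^ k * w k) :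
    ∃ C > 0, ∃ ρ > 0, ∀ k, ∀ x ∈ K, ‖iteratedFDeriv ℝ k f x‖ ≤ C * ρ ^ k * w k := by
  -- All normalised values of the `k`-th derivative over `K` form the `k`-th set, so a single use of
  -- the norming property yields constants uniform in order, point and direction.
  obtain ⟨C, hC, ρ, hρ, H⟩ := hΛ (fun k => {g | ∃ x ∈ K, ∃ v : Fin k → E,
      g = (w k * ∏ j, ‖v j‖)⁻¹ • iteratedFDeriv ℝ k f x v}) fun i => by
    obtain ⟨C, ρ, hC, hρ, H⟩ := h i
    refine ⟨C, ρ, ?_⟩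
    rintro k _ ⟨x, hx, v, rfl⟩
    have hd : ContDiffAt ℝ ∞ f x := hf.contDiffAt (hU.mem_nhds (hK hx))
    have e' := map_iteratedFDeriv (Λ i) hd k v
    have hp : 0 ≤ ∏ j, ‖v j‖ := Finset.prod_nonneg fun _ _ => norm_nonneg _
    rw [map_smul, e', norm_smul, norm_inv, Real.norm_of_nonneg (mul_nonneg (hw k).le hp)]
    refine inv_mul_le_of_le_mul₀ (mul_nonneg (hw k).le hp) (by positivity) ?_
    refine ((iteratedFDeriv ℝ k (fun x => Λ i (f x)) x).le_opNorm v).trans ?_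
    exact (mul_le_mul_of_nonneg_right (H k x hx) hp).trans_eq (by ring)
  refine ⟨C, hC, ρ, hρ, fun k x hx => ?_⟩
  refine ContinuousMultilinearMap.opNorm_le_bound
    (mul_nonneg (by positivity) (hw k).le) fun v => ?_
  by_cases hv : ∃ j, v j = 0
  · obtain ⟨j, hj⟩ := hv
    rw [(iteratedFDeriv ℝ k f x).map_coord_zero j hj, norm_zero]
    exact mul_nonneg (mul_nonneg (by positivity) (hw k).le)
      (Finset.prod_nonneg fun _ _ => norm_nonneg _)
  push Not at hv
  have hp : 0 < ∏ j, ‖v j‖ := Finset.prod_pos fun j _ => norm_pos_iff.2 (hv j)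
  have h1 := H k _ ⟨x, hx, v, rfl⟩
  have hwp := mul_pos (hw k) hp
  rw [norm_smul, norm_inv, Real.norm_of_nonneg hwp.le, inv_mul_le_iff₀ hwp] at h1
  exact h1.trans_eq (by ring)

end IsNorming

end Norming

/-! ## From weak to strong differentiability -/

section WeakStrong

variable {ι E F G : Type*} [NormedAddCommGroup E] [NormedSpace ℝ E]
  [NormedAddCommGroup F] [NormedSpace ℝ F] [NormedAddCommGroup G] [NormedSpace ℝ G]

/-- The `k`-th derivative is the sum of `p k` over the `k!` permutations of its arguments, and `‖p
k‖` grows at most geometrically. -/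
theorem exists_iteratedFDeriv_bound_of_analyticAt [CompleteSpace F] {h : E → F} {x₀ : E}
    (hh : AnalyticAt ℝ h x₀) : ∃ C ρ : ℝ, 0 ≤ C ∧ 0 ≤ ρ ∧ ∀ k : ℕ,
      ‖iteratedFDeriv ℝ k h x₀‖ ≤ C * ρ ^ k * (Nat.factorial k : ℝ) := by
  obtain ⟨p, R, hp⟩ := hh
  obtain ⟨r, hr0, hr⟩ := ENNReal.lt_iff_exists_nnreal_btwn.1 (hp.r_pos.trans_le hp.r_le)
  obtain ⟨C, hC, H⟩ := p.norm_mul_pow_le_of_lt_radius hr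
  have hr0' : (0 : ℝ) < r := by exact_mod_cast hr0
  refine ⟨C, (r : ℝ)⁻¹, hC.le, by positivity, fun k => ?_⟩
  have hpk : ‖p k‖ ≤ C * (r : ℝ)⁻¹ ^ k := by
    rw [inv_pow, ← div_eq_mul_inv, le_div_iff₀ (by positivity)]
    exact H k
  refine ContinuousMultilinearMap.opNorm_le_bound (by positivity) fun v => ?_
  rw [hp.iteratedFDeriv_eq_sum_of_completeSpace]
  calc ‖∑ σ : Equiv.Perm (Fin k), p k fun i => v (σ i)‖
      ≤ ∑ σ : Equiv.Perm (Fin k), ‖p k‖ * ∏ i, ‖v i‖ := by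
        refine (norm_sum_le _ _).trans (Finset.sum_le_sum fun σ _ => ?_)
        rw [← Equiv.prod_comp σ fun i => ‖v i‖]
        exact (p k).le_opNorm _
    _ = ‖p k‖ * (Nat.factorial k : ℝ) * ∏ i, ‖v i‖ := by
        rw [Finset.sum_const, Finset.card_univ, Fintype.card_perm, Fintype.card_fin, nsmul_eq_mul]
        ring
    _ ≤ _ := by
        have : 0 ≤ ∏ i, ‖v i‖ := Finset.prod_nonneg fun _ _ => norm_nonneg _
        gcongr

variable {Λ : ι → G →L[ℝ] F} {f : E → G} {U : Set E}

/-- Uniform derivative bounds make the Taylor series of `f` converge in norm; it remains to identify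
its sum with `f` through the functionals. -/
theorem IsNorming.analyticOnNhd [CompleteSpace F] [CompleteSpace G] [FiniteDimensional ℝ E]
    (hΛ : IsNorming Λ) (hU : IsOpen U) (hf : ∀ i, AnalyticOnNhd ℝ (fun x => Λ i (f x)) U) :
    AnalyticOnNhd ℝ f U := by
  intro x₀ hx₀
  have hfs : ContDiffOn ℝ ∞ f U := hΛ.contDiffOn hU fun i => (hf i).contDiffOn hU.uniqueDiffOn
  obtain ⟨C, hC, ρ, hρ, H⟩ := hΛ.exists_iteratedFDeriv_bound (K := {x₀})
    (w := fun k => (Nat.factorial k : ℝ)) hU hfs (singleton_subset_iff.2 hx₀)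
    (fun k => by positivity) fun i => by
      obtain ⟨C, ρ, hC, hρ, H⟩ := exists_iteratedFDeriv_bound_of_analyticAt (hf i x₀ hx₀)
      exact ⟨C, ρ, hC, hρ, fun k x hx => by rw [mem_singleton_iff.1 hx]; exact H k⟩
  obtain ⟨R, hR, hRU⟩ := Metric.isOpen_iff.1 hU x₀ hx₀
  let p : FormalMultilinearSeries ℝ E G := fun k =>
    (Nat.factorial k : ℝ)⁻¹ • iteratedFDeriv ℝ k f x₀
  let ρ' : NNReal := ⟨ρ⁻¹, by positivity⟩
  have hpr : (ρ' : ENNReal) ≤ p.radius := by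
    refine p.le_radius_of_bound C fun k => ?_
    have h1 := H k x₀ rfl
    have h2 : ‖p k‖ ≤ C * ρ ^ k := by
      simp only [p]
      rw [norm_smul, norm_inv, Real.norm_natCast, inv_mul_le_iff₀ (by positivity)]
      linarith
    calc ‖p k‖ * ρ⁻¹ ^ k ≤ C * ρ ^ k * ρ⁻¹ ^ k := by gcongr
      _ = C := by rw [mul_assoc, ← mul_pow, mul_inv_cancel₀ hρ.ne', one_pow, mul_one]
  have hp0 : 0 < p.radius := lt_of_lt_of_le
    (by rw [ENNReal.coe_pos]; exact inv_pos.2 hρ) hpr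
  have hp := (p.hasFPowerSeriesOnBall hp0).comp_sub x₀
  rw [zero_add] at hp
  set h : E → G := fun x => p.sum (x - x₀)
  set B := Metric.ball x₀ (min R ρ⁻¹)
  have hr1 : 0 < min R ρ⁻¹ := lt_min hR (inv_pos.2 hρ)
  have hBU : B ⊆ U := (Metric.ball_subset_ball (min_le_left _ _)).trans hRU
  have hBr : B ⊆ Metric.eball x₀ p.radius := by
    refine fun x hx => lt_of_lt_of_le ?_ hpr
    rw [edist_lt_coe, ← NNReal.coe_lt_coe, coe_nndist]
    exact lt_of_lt_of_le hx (min_le_right _ _)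
  have hhB : AnalyticOnNhd ℝ h B := hp.analyticOnNhd.mono hBr
  -- Equality is immediate only on a neighbourhood depending on `i`; the identity theorem spreads it
  -- to the common ball `B`, where the functionals separate points.
  have hev : ∀ i, EqOn (fun x => Λ i (f x)) (fun x => Λ i (h x)) B := by
    intro i
    refine ((hf i).mono hBU).eqOn_of_preconnected_of_eventuallyEq
      (fun x hx => ((Λ i).analyticAt _).comp (hhB x hx)) (convex_ball _ _).isPreconnected
      (Metric.mem_ball_self hr1) ?_
    obtain ⟨q, r, hq⟩ := hf i x₀ hx₀
    filter_upwards [Metric.eball_mem_nhds x₀ hq.r_pos, Metric.eball_mem_nhds x₀ hp0] with x hx hx'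
    have e1 := hq.hasSum_iteratedFDeriv (y := x - x₀)
      (by rwa [Metric.mem_eball, edist_zero_right, ← edist_eq_enorm_sub])
    have e2 := (hp.hasSum (y := x - x₀)
      (by rwa [Metric.mem_eball, edist_zero_right, ← edist_eq_enorm_sub])).mapL (Λ i)
    rw [add_sub_cancel] at e1 e2
    refine e1.unique (Eq.subst (motive := fun t => HasSum t _) (funext fun k => ?_) e2)
    have hd : ContDiffAt ℝ ∞ f x₀ := hfs.contDiffAt (hU.mem_nhds hx₀)
    exact ((Λ i).map_smul _ _).trans (congrArg _ (map_iteratedFDeriv (Λ i) hd k _))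
  have hfh : EqOn f h B := fun x hx => hΛ.ext fun i => hev i hx
  exact (hhB x₀ (Metric.mem_ball_self hr1)).congr
    ((hfh.eventuallyEq_of_mem (Metric.ball_mem_nhds x₀ hr1)).symm)

theorem IsNorming.isOn [CompleteSpace F] [CompleteSpace G] [FiniteDimensional ℝ E]
    (hΛ : IsNorming Λ) {κ : DiffClass} (hκ : κ.Admissible) (hU : IsOpen U)
    (hf : ∀ i, κ.IsOn (fun x => Λ i (f x)) U) : κ.IsOn f U := by
  cases κ with
  | analytic => exact hΛ.analyticOnNhd hU hf
  | denjoyCarleman M =>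
    have hfs : ContDiffOn ℝ ∞ f U := hΛ.contDiffOn hU fun i => (hf i).1
    have hM : IsLogConvexWeight M := hκ
    refine ⟨hfs, fun K hK hKc => ?_⟩
    obtain ⟨C, hC, ρ, hρ, H⟩ := hΛ.exists_iteratedFDeriv_bound (K := K)
      (w := fun k => (Nat.factorial k : ℝ) * M k) hU hfs hK
      (fun k => mul_pos (by positivity) (hM.pos k)) fun i => by
        obtain ⟨C, hC, ρ, hρ, H⟩ := (hf i).2 K hK hKc
        exact ⟨C, ρ, hC.le, hρ.le, fun k x hx => (H k x hx).trans_eq (by ring)⟩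
    exact ⟨C, hC, ρ, hρ, fun k x hx => (H k x hx).trans_eq (by ring)⟩
  | smooth => exact hΛ.contDiffOn hU hf
  | holder α =>
    intro K hK hKc
    -- A Hölder estimate is boundedness of the set of Hölder quotients.
    obtain ⟨C, hC, H⟩ := hΛ.exists_bound (S := (fun p : E × E =>
        (‖p.1 - p.2‖ ^ α)⁻¹ • (f p.1 - f p.2)) '' (K ×ˢ K)) fun i => by
      obtain ⟨C, hC, H⟩ := hf i K hK hKc
      refine ⟨C, ?_⟩
      rintro _ ⟨⟨x, y⟩, ⟨hx, hy⟩, rfl⟩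
      have hn : 0 ≤ ‖x - y‖ ^ α := Real.rpow_nonneg (norm_nonneg _) _
      rw [map_smul, norm_smul, norm_inv, Real.norm_of_nonneg hn, map_sub]
      exact inv_mul_le_of_le_mul₀ hn hC.le ((H x hx y hy).trans_eq (mul_comm _ _))
    refine ⟨C, hC, fun x hx y hy => ?_⟩
    rcases eq_or_ne x y with rfl | hne
    · simpa using mul_nonneg hC.le (Real.rpow_nonneg le_rfl α)
    have hn : 0 < ‖x - y‖ ^ α := Real.rpow_pos_of_pos (norm_pos_iff.2 (sub_ne_zero.2 hne)) _
    have h1 := H _ (mem_image_of_mem _ (mk_mem_prod hx hy))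
    rw [norm_smul, norm_inv, Real.norm_of_nonneg hn.le, inv_mul_le_iff₀ hn] at h1
    exact h1.trans_eq (mul_comm _ _)

end WeakStrong

/-! ## Inversion -/

section Inversion

variable {P W H : Type*} [NormedAddCommGroup P] [NormedSpace ℝ P]
  [NormedAddCommGroup W] [NormedSpace ℂ W]
  [NormedAddCommGroup H] [NormedSpace ℂ H]

/-- Composition of complex operators, as a real bilinear map. -/
def compRealL (X Y Z : Type*) [NormedAddCommGroup X] [NormedSpace ℂ X] [NormedAddCommGroup Y]
    [NormedSpace ℂ Y] [NormedAddCommGroup Z] [NormedSpace ℂ Z] :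
    (Y →L[ℂ] Z) →L[ℝ] (X →L[ℂ] Y) →L[ℝ] (X →L[ℂ] Z) :=
  (ContinuousLinearMap.compL ℂ X Y Z).bilinearRestrictScalars ℝ

theorem compRealL_apply {X Y Z : Type*} [NormedAddCommGroup X] [NormedSpace ℂ X]
    [NormedAddCommGroup Y] [NormedSpace ℂ Y] [NormedAddCommGroup Z] [NormedSpace ℂ Z]
    (S : Y →L[ℂ] Z) (T : X →L[ℂ] Y) : compRealL X Y Z S T = S.comp T := rfl

variable {B : P → W →L[ℂ] H} {O : Set P}

theorem contDiffOn_inverse [CompleteSpace W] {n : WithTop ℕ∞} (hB : ContDiffOn ℝ n B O)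
    (hinv : ∀ p ∈ O, (B p).IsInvertible) : ContDiffOn ℝ n (fun p => (B p).inverse) O := by
  intro p hp
  obtain ⟨e, he⟩ := hinv p hp
  have h1 : ContDiffAt ℝ n (ContinuousLinearMap.inverse : (W →L[ℂ] H) → _) (B p) := by
    rw [← he]
    exact (contDiffAt_map_inverse (𝕜 := ℂ) e).restrict_scalars ℝ
  exact h1.comp_contDiffWithinAt p (hB p hp)

theorem inverse_sub_inverse {S T : W →L[ℂ] H} (hS : S.IsInvertible) (hT : T.IsInvertible) :
    S.inverse - T.inverse = T.inverse.comp ((T - S).comp S.inverse) := by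
  rw [ContinuousLinearMap.sub_comp, ContinuousLinearMap.comp_sub,
    ← ContinuousLinearMap.comp_assoc, hT.inverse_comp_self, hS.self_comp_inverse]
  simp

set_option maxSynthPendingDepth 3 in
theorem norm_compRealL_le (X Y Z : Type*) [NormedAddCommGroup X] [NormedSpace ℂ X]
    [NormedAddCommGroup Y] [NormedSpace ℂ Y] [NormedAddCommGroup Z] [NormedSpace ℂ Z] :
    ‖compRealL X Y Z‖ ≤ 1 := by
  rw [compRealL, ContinuousLinearMap.norm_bilinearRestrictScalars]
  exact ContinuousLinearMap.norm_compL_le ..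

set_option maxSynthPendingDepth 3 in
-- With `x` frozen, `(B y)⁻¹ = (B x)⁻¹ - (B x)⁻¹ (B y - B x) (B y)⁻¹` near `x`. In the Leibniz
-- formula at `y = x` the top derivative of the inverse meets the factor `B x - B x = 0`, so the
-- bound is a recursion in lower orders.
theorem norm_iteratedFDeriv_inverse_le_sum [CompleteSpace W] (hO : IsOpen O)
    (hB : ContDiffOn ℝ ∞ B O) (hinv : ∀ p ∈ O, (B p).IsInvertible) {x : P} (hx : x ∈ O) (k : ℕ) :
    ‖iteratedFDeriv ℝ (k + 1) (fun p => (B p).inverse) x‖ ≤ ‖(B x).inverse‖ *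
      ∑ i ∈ Finset.range (k + 1), ((k + 1).choose (i + 1) : ℝ) * ‖iteratedFDeriv ℝ (i + 1) B x‖ *
        ‖iteratedFDeriv ℝ (k - i) (fun p => (B p).inverse) x‖ := by
  have hR : ContDiffOn ℝ ∞ (fun p => (B p).inverse) O := contDiffOn_inverse hB hinv
  set N : P → H →L[ℂ] H := fun y => compRealL H W H (B y - B x) (B y).inverse
  have hBs : ContDiffOn ℝ ∞ (fun y => B y - B x) O := hB.sub contDiffOn_const
  have hN : ContDiffOn ℝ ∞ N O :=
    ((compRealL H W H).contDiff.comp_contDiffOn hBs).clm_apply hR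
  have hNx : ContDiffAt ℝ ∞ N x := hN.contDiffAt (hO.mem_nhds hx)
  set L := compRealL H H W (B x).inverse
  have hL : ‖L‖ ≤ ‖(B x).inverse‖ :=
    ((compRealL H H W).le_opNorm _).trans
      (mul_le_of_le_one_left (norm_nonneg _) (norm_compRealL_le _ _ _))
  have e0 : (fun p => (B p).inverse) =ᶠ[𝓝 x] fun p => (B x).inverse - L (N p) := by
    filter_upwards [hO.mem_nhds hx] with y hy
    have h2 : L (N y) = (B x).inverse - (B y).inverse := by
      have h3 := inverse_sub_inverse (hinv y hy) (hinv x hx)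
      have h4 : L (N y) = (B x).inverse.comp ((B y - B x).comp (B y).inverse) := rfl
      rw [h4, ← neg_sub (B x) (B y), ContinuousLinearMap.neg_comp, ContinuousLinearMap.comp_neg,
        ← h3, neg_sub]
    rw [h2, sub_sub_cancel]
  have e1 : ‖iteratedFDeriv ℝ (k + 1) (fun p => (B p).inverse) x‖ ≤
      ‖L‖ * ‖iteratedFDeriv ℝ (k + 1) N x‖ := by
    rw [(e0.iteratedFDeriv ℝ (k + 1)).eq_of_nhds]
    have hLN : ContDiffAt ℝ ∞ (fun p => L (N p)) x := L.contDiff.contDiffAt.comp x hNx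
    have e2 := iteratedFDeriv_sub_apply (𝕜 := ℝ) (i := k + 1) (x := x)
      (f := fun _ : P => (B x).inverse) (g := fun p => L (N p)) contDiffAt_const
      (hLN.of_le (by exact_mod_cast le_top))
    have e3 : iteratedFDeriv ℝ (k + 1) (fun p => (B x).inverse - L (N p)) x = _ := e2
    rw [e3, iteratedFDeriv_const_of_ne (Nat.succ_ne_zero k), Pi.zero_apply, zero_sub, norm_neg]
    exact L.norm_iteratedFDeriv_comp_left hNx (by exact_mod_cast le_top)
  have e4 := (compRealL H W H).norm_iteratedFDerivWithin_le_of_bilinear_of_le_one hBs hR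
    hO.uniqueDiffOn hx (n := k + 1) (by exact_mod_cast le_top) (norm_compRealL_le _ _ _)
  simp only [iteratedFDerivWithin_of_isOpen _ hO hx] at e4
  rw [Finset.sum_range_succ'] at e4
  have e5 : iteratedFDeriv ℝ 0 (fun y => B y - B x) x = 0 := by
    ext; simp
  have e6 : ∀ i : ℕ, iteratedFDeriv ℝ (i + 1) (fun y => B y - B x) x =
      iteratedFDeriv ℝ (i + 1) B x := by
    intro i
    have hBx : ContDiffAt ℝ ∞ B x := hB.contDiffAt (hO.mem_nhds hx)
    have e2 := iteratedFDeriv_sub_apply (𝕜 := ℝ) (i := i + 1) (x := x)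
      (f := B) (g := fun _ : P => B x) (hBx.of_le (by exact_mod_cast le_top)) contDiffAt_const
    have e3 : iteratedFDeriv ℝ (i + 1) (fun y => B y - B x) x = _ := e2
    rw [e3, iteratedFDeriv_const_of_ne (Nat.succ_ne_zero i), Pi.zero_apply, sub_zero]
  have e7 : ∀ i, ‖iteratedFDeriv ℝ (k + 1 - (i + 1)) (fun p => (B p).inverse) x‖ =
      ‖iteratedFDeriv ℝ (k - i) (fun p => (B p).inverse) x‖ := fun i => by
    rw [Nat.add_sub_add_right]
  simp only [e5, e6, e7, norm_zero, mul_zero, zero_mul, add_zero] at e4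
  exact e1.trans (mul_le_mul hL e4 (norm_nonneg _) (norm_nonneg _))

theorem norm_iteratedFDeriv_inverse_le [CompleteSpace W] {M : ℕ → ℝ} (hM : IsLogConvexWeight M)
    (hO : IsOpen O) (hB : ContDiffOn ℝ ∞ B O) (hinv : ∀ p ∈ O, (B p).IsInvertible) {x : P}
    (hx : x ∈ O) {r C ρ : ℝ} (hr : ‖(B x).inverse‖ ≤ r) (hC : 0 ≤ C) (hρ : 0 ≤ ρ)
    (H : ∀ k : ℕ, ‖iteratedFDeriv ℝ k B x‖ ≤ C * ρ ^ k * (Nat.factorial k : ℝ) * M k) (k : ℕ) :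
    ‖iteratedFDeriv ℝ k (fun p => (B p).inverse) x‖ ≤
      r * (ρ * (1 + r * C)) ^ k * (Nat.factorial k : ℝ) * M k := by
  have hr0 : 0 ≤ r := (norm_nonneg _).trans hr
  -- With this `a` the geometric sum telescopes: `r * C * ∑ j ≤ k, a ^ j = a ^ (k + 1) - 1`, which
  -- closes the induction.
  set a := 1 + r * C with ha
  have ha0 : 0 ≤ a := by positivity
  induction k using Nat.strong_induction_on with
  | _ k ih =>
  match k with
  | 0 => simpa [hM.zero_eq_one] using hr
  | k + 1 =>
    have key : ∀ i ∈ Finset.range (k + 1),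
        ((k + 1).choose (i + 1) : ℝ) * ‖iteratedFDeriv ℝ (i + 1) B x‖ *
          ‖iteratedFDeriv ℝ (k - i) (fun p => (B p).inverse) x‖ ≤
        (Nat.factorial (k + 1) : ℝ) * M (k + 1) * C * r * ρ ^ (k + 1) * a ^ (k - i) := by
      intro i hi
      have hik : i ≤ k := Nat.lt_succ_iff.1 (Finset.mem_range.1 hi)
      have h1 := H (i + 1)
      have h2 := ih (k - i) (by omega)
      have hf : ((k + 1).choose (i + 1) : ℝ) * (Nat.factorial (i + 1) : ℝ) *
          (Nat.factorial (k - i) : ℝ) = (Nat.factorial (k + 1) : ℝ) := by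
        have := Nat.choose_mul_factorial_mul_factorial (n := k + 1) (k := i + 1) (by omega)
        rw [Nat.add_sub_add_right] at this
        exact_mod_cast this
      have hMM : M (i + 1) * M (k - i) ≤ M (k + 1) := by
        have := hM.mul_le_add (i + 1) (k - i)
        rwa [show i + 1 + (k - i) = k + 1 by omega] at this
      have hρ' : ρ ^ (i + 1) * ρ ^ (k - i) = ρ ^ (k + 1) := by
        rw [← pow_add, show i + 1 + (k - i) = k + 1 by omega]
      have p1 := (hM.pos (i + 1)).le
      calc _ ≤ ((k + 1).choose (i + 1) : ℝ) *
            (C * ρ ^ (i + 1) * (Nat.factorial (i + 1) : ℝ) * M (i + 1)) *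
            (r * (ρ * a) ^ (k - i) * (Nat.factorial (k - i) : ℝ) * M (k - i)) := by
            gcongr
        _ = (((k + 1).choose (i + 1) : ℝ) * (Nat.factorial (i + 1) : ℝ) *
            (Nat.factorial (k - i) : ℝ)) * (C * r * (ρ ^ (i + 1) * ρ ^ (k - i)) * a ^ (k - i)) *
            (M (i + 1) * M (k - i)) := by rw [mul_pow]; ring
        _ ≤ (Nat.factorial (k + 1) : ℝ) * (C * r * ρ ^ (k + 1) * a ^ (k - i)) * M (k + 1) := by
            rw [hf, hρ']
            gcongr
        _ = _ := by ring
    have hgeom : r * C * ∑ i ∈ Finset.range (k + 1), a ^ (k - i) ≤ a ^ (k + 1) := by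
      have h1 := Finset.sum_range_reflect (fun i => a ^ i) (k + 1)
      simp only [Nat.add_sub_cancel] at h1
      have h2 := geom_sum_mul a (k + 1)
      rw [h1, mul_comm]
      have h3 : a - 1 = r * C := by rw [ha]; ring
      rw [h3] at h2
      linarith
    have hMk := (hM.pos (k + 1)).le
    calc _ ≤ _ := norm_iteratedFDeriv_inverse_le_sum hO hB hinv hx k
      _ ≤ r * ∑ i ∈ Finset.range (k + 1),
          (Nat.factorial (k + 1) : ℝ) * M (k + 1) * C * r * ρ ^ (k + 1) * a ^ (k - i) :=
        mul_le_mul hr (Finset.sum_le_sum key) (Finset.sum_nonneg fun _ _ => by positivity) hr0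
      _ = (r * C * ∑ i ∈ Finset.range (k + 1), a ^ (k - i)) *
          (r * ρ ^ (k + 1) * (Nat.factorial (k + 1) : ℝ) * M (k + 1)) := by
        rw [← Finset.mul_sum]; ring
      _ ≤ a ^ (k + 1) * (r * ρ ^ (k + 1) * (Nat.factorial (k + 1) : ℝ) * M (k + 1)) :=
        mul_le_mul_of_nonneg_right hgeom (by positivity)
      _ = _ := by rw [mul_pow]; ring

theorem isOn_inverse [CompleteSpace W] [LocallyCompactSpace P] {κ : DiffClass}
    (hκ : κ.Admissible) (hO : IsOpen O) (hB : κ.IsOn B O) (hinv : ∀ p ∈ O, (B p).IsInvertible) :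
    κ.IsOn (fun p => (B p).inverse) O := by
  have hcont : ContinuousOn (fun p => (B p).inverse) O :=
    contDiffOn_zero.1 (contDiffOn_inverse (contDiffOn_zero.2 (hB.continuousOn hκ hO)) hinv)
  have hbdd : ∀ K ⊆ O, IsCompact K → ∃ r > 0, ∀ x ∈ K, ‖(B x).inverse‖ ≤ r := by
    intro K hK hKc
    obtain ⟨r, hr⟩ := hKc.exists_bound_of_continuousOn (hcont.mono hK)
    exact ⟨|r| + 1, by positivity, fun x hx => (hr x hx).trans (by linarith [le_abs_self r])⟩
  cases κ with
  | analytic =>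
    intro x hx
    have h : ContDiffOn ℝ ω B O := AnalyticOnNhd.contDiffOn hB hO.uniqueDiffOn
    exact ((contDiffOn_inverse h hinv).contDiffAt (hO.mem_nhds hx)).analyticAt
  | denjoyCarleman M =>
    refine ⟨contDiffOn_inverse hB.1 hinv, fun K hK hKc => ?_⟩
    obtain ⟨C, hC, ρ, hρ, H⟩ := hB.2 K hK hKc
    obtain ⟨r, hr0, hr⟩ := hbdd K hK hKc
    exact ⟨r, hr0, ρ * (1 + r * C), by positivity, fun k x hx =>
      norm_iteratedFDeriv_inverse_le hκ hO hB.1 hinv (hK hx) (hr x hx) hC.le hρ.le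
        (fun k => H k x hx) k⟩
  | smooth => exact contDiffOn_inverse hB hinv
  | holder α =>
    intro K hK hKc
    obtain ⟨C, hC, H⟩ := hB K hK hKc
    obtain ⟨r, hr0, hr⟩ := hbdd K hK hKc
    refine ⟨r * (C * r), by positivity, fun x hx y hy => ?_⟩
    rw [inverse_sub_inverse (hinv x (hK hx)) (hinv y (hK hy))]
    have hn : 0 ≤ ‖x - y‖ ^ α := Real.rpow_nonneg (norm_nonneg _) _
    calc _ ≤ ‖(B y).inverse‖ * (‖B y - B x‖ * ‖(B x).inverse‖) :=
          (ContinuousLinearMap.opNorm_comp_le _ _).trans (mul_le_mul_of_nonneg_left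
            (ContinuousLinearMap.opNorm_comp_le _ _) (norm_nonneg _))
      _ ≤ r * ((C * ‖x - y‖ ^ α) * r) := by
          have h1 := H y hy x hx
          rw [norm_sub_rev y x] at h1
          have h2 := hr x hx
          have h3 := hr y hy
          gcongr
      _ = _ := by ring

end Inversion

/-! ## Operators on graph spaces -/

section GraphOperators

variable {H : Type*} [NormedAddCommGroup H] [InnerProductSpace ℂ H]
variable {V : Submodule ℂ H}

theorem norm_le_graphNorm (B : V →ₗ[ℂ] H) (u : V) : ‖(u : H)‖ ≤ graphNorm B u :=
  Real.le_sqrt_of_sq_le (by nlinarith [sq_nonneg ‖B u‖])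

theorem graphNorm_nonneg (B : V →ₗ[ℂ] H) (u : V) : 0 ≤ graphNorm B u := Real.sqrt_nonneg _

theorem graphNorm_le_add (B : V →ₗ[ℂ] H) (u : V) : graphNorm B u ≤ ‖(u : H)‖ + ‖B u‖ :=
  Real.sqrt_le_iff.2 ⟨by positivity, by nlinarith [norm_nonneg (u : H), norm_nonneg (B u)]⟩

theorem graphNorm_eq_norm (B : V →ₗ[ℂ] H) (u : V) :
    graphNorm B u = ‖WithLp.toLp 2 ((u : H), B u)‖ := by
  rw [WithLp.prod_norm_eq_of_L2]; rfl

theorem graphNorm_le_add_norm_sub (B B' : V →ₗ[ℂ] H) (u : V) :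
    graphNorm B u ≤ graphNorm B' u + ‖B u - B' u‖ := by
  have h : WithLp.toLp 2 ((u : H), B u) =
      WithLp.toLp 2 ((u : H), B' u) + WithLp.toLp 2 ((0 : H), B u - B' u) := by
    rw [← WithLp.toLp_add]; simp
  rw [graphNorm_eq_norm, graphNorm_eq_norm, h]
  refine (norm_add_le _ _).trans_eq ?_
  congr 1
  rw [WithLp.prod_norm_eq_of_L2]
  simp

namespace GraphSpace

/-- The graph space is isometric to the graph, a closed subset of the complete space `H × H`. -/
theorem completeSpace [CompleteSpace H] {B : V →ₗ[ℂ] H} (hB : (LinearPMap.mk V B).IsClosed) :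
    CompleteSpace (GraphSpace B) := by
  have hiso : Isometry (toGraph B) := AddMonoidHomClass.isometry_of_norm _ fun _ => rfl
  rw [completeSpace_iff_isComplete_range hiso.isUniformInducing]
  refine IsClosed.isComplete ?_
  have : range (toGraph B) = (WithLp.ofLp : WithLp 2 (H × H) → H × H) ⁻¹'
      ((LinearPMap.mk V B).graph : Set (H × H)) := by
    ext x
    simp only [mem_range, mem_preimage, SetLike.mem_coe, LinearPMap.mem_graph_iff]
    constructor
    · rintro ⟨u, rfl⟩
      exact ⟨(of B).symm u, rfl, rfl⟩
    · rintro ⟨u, h1, h2⟩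
      refine ⟨of B u, ?_⟩
      apply (WithLp.ofLp_injective 2)
      exact Prod.ext h1 h2
  rw [this]
  exact IsClosed.preimage (WithLp.prod_continuous_ofLp 2 H H) hB

/-- The embedding of the graph space of `B` into `H`. -/
def incl (B : V →ₗ[ℂ] H) : GraphSpace B →L[ℂ] H :=
  (V.subtype ∘ₗ (of B).symm.toLinearMap).mkContinuous 1 fun u => by
    rw [one_mul]
    have h : ‖u‖ = graphNorm B ((of B).symm u) := norm_of B ((of B).symm u)
    rw [h]
    exact norm_le_graphNorm B _

theorem incl_of (B : V →ₗ[ℂ] H) (u : V) : incl B (of B u) = u := rfl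

open Classical in
/-- The operator `B'`, as a bounded operator on the graph space of `B` (and `0` if it is not
bounded). -/
def toCLM (B B' : V →ₗ[ℂ] H) : GraphSpace B →L[ℂ] H :=
  if h : Continuous (B' ∘ₗ (of B).symm.toLinearMap) then ⟨B' ∘ₗ (of B).symm.toLinearMap, h⟩ else 0

/-- Closed graph theorem: the graph of `B'` over the graph space of `B` is the preimage of its
closed graph in `H × H` under a continuous map. -/
theorem toCLM_apply [CompleteSpace H] {B B' : V →ₗ[ℂ] H} (hB : (LinearPMap.mk V B).IsClosed)
    (hB' : (LinearPMap.mk V B').IsClosed) (u : V) : toCLM B B' (of B u) = B' u := by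
  have := completeSpace hB
  have h : Continuous (B' ∘ₗ (of B).symm.toLinearMap) := by
    refine LinearMap.continuous_of_isClosed_graph _ ?_
    have : ((B' ∘ₗ (of B).symm.toLinearMap).graph : Set (GraphSpace B × H)) =
        (fun p : GraphSpace B × H => (incl B p.1, p.2)) ⁻¹'
          ((LinearPMap.mk V B').graph : Set (H × H)) := by
      ext ⟨u, x⟩
      simp only [mem_preimage, SetLike.mem_coe, LinearPMap.mem_graph_iff, LinearMap.mem_graph_iff]
      constructor
      · rintro rfl
        exact ⟨(of B).symm u, rfl, rfl⟩
      · rintro ⟨v, h1, h2⟩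
        have : v = (of B).symm u := Subtype.ext h1
        rw [← h2, this]; rfl
    rw [this]
    exact IsClosed.preimage (by fun_prop) hB'
  rw [toCLM, dif_pos h]
  rfl

theorem norm_apply_le [CompleteSpace H] {B B' : V →ₗ[ℂ] H}
    (hB : (LinearPMap.mk V B).IsClosed) (hB' : (LinearPMap.mk V B').IsClosed) (u : V) :
    ‖B' u‖ ≤ ‖toCLM B B'‖ * graphNorm B u := by
  rw [← toCLM_apply hB hB', ← norm_of]
  exact (toCLM B B').le_opNorm _

theorem graphNorm_le [CompleteSpace H] {B B' : V →ₗ[ℂ] H}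
    (hB : (LinearPMap.mk V B).IsClosed) (hB' : (LinearPMap.mk V B').IsClosed) (u : V) :
    graphNorm B' u ≤ (1 + ‖toCLM B B'‖) * graphNorm B u := by
  linarith [graphNorm_le_add B' u, norm_le_graphNorm B u, norm_apply_le hB hB' u]

end GraphSpace

open GraphSpace

/-! ## Resolvents -/

/-- By the open mapping theorem bijectivity is invertibility. The reference operator `B` stays fixed
while `B'` and `z` vary, so everything happens in one Banach space of operators. -/
theorem inResolventSet_iff [CompleteSpace H] {B B' : V →ₗ[ℂ] H}
    (hB : (LinearPMap.mk V B).IsClosed) (hB' : (LinearPMap.mk V B').IsClosed) (z : ℂ) :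
    InResolventSet B' z ↔ (toCLM B B' - z • incl B).IsInvertible := by
  have := completeSpace hB
  have e : (fun u : V => B' u - z • (u : H)) = (toCLM B B' - z • incl B) ∘ of B := by
    ext u
    simp [toCLM_apply hB hB', incl_of]
  have hiff : InResolventSet B' z ↔ Function.Bijective (toCLM B B' - z • incl B) := by
    rw [InResolventSet, e]
    exact Function.Bijective.of_comp_iff _ (of B).bijective
  rw [hiff]
  refine ⟨fun h => ?_, fun h => h.bijective⟩
  exact ⟨ContinuousLinearEquiv.ofBijective _ (LinearMap.ker_eq_bot.2 h.1)
    (LinearMap.range_eq_top.2 h.2), ContinuousLinearEquiv.coe_ofBijective _ _ _⟩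

theorem IsResolventAt.unique {B : V →ₗ[ℂ] H} {z : ℂ} {R R' : H →L[ℂ] H}
    (h : IsResolventAt B z R) (h' : IsResolventAt B z R') : R = R' := by
  ext x
  obtain ⟨u, hu, hux⟩ := h.2 x
  have := h'.1 u
  rw [hux] at this
  rw [this, hu]

theorem IsResolventAt.resolventOp_eq {B : V →ₗ[ℂ] H} {z : ℂ} {R : H →L[ℂ] H}
    (h : IsResolventAt B z R) : resolventOp B z = R := by
  have hex : ∃ R : H →L[ℂ] H, IsResolventAt B z R := ⟨R, h⟩
  rw [resolventOp, dif_pos hex]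
  exact hex.choose_spec.unique h

theorem isResolventAt_inverse [CompleteSpace H] {B B' : V →ₗ[ℂ] H}
    (hB : (LinearPMap.mk V B).IsClosed) (hB' : (LinearPMap.mk V B').IsClosed) {z : ℂ}
    (hz : InResolventSet B' z) :
    IsResolventAt B' z ((incl B).comp (toCLM B B' - z • incl B).inverse) := by
  have hi := (inResolventSet_iff hB hB' z).1 hz
  have e : ∀ u : V, B' u - z • (u : H) = (toCLM B B' - z • incl B) (of B u) := fun u => by
    simp [toCLM_apply hB hB', incl_of]
  refine ⟨fun u => ?_, fun x => ?_⟩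
  · rw [e, ContinuousLinearMap.comp_apply, hi.inverse_apply_self, incl_of]
  · refine ⟨(of B).symm ((toCLM B B' - z • incl B).inverse x), rfl, ?_⟩
    rw [e, LinearEquiv.apply_symm_apply, hi.self_apply_inverse]

theorem resolventOp_eq [CompleteSpace H] {B B' : V →ₗ[ℂ] H}
    (hB : (LinearPMap.mk V B).IsClosed) (hB' : (LinearPMap.mk V B').IsClosed) {z : ℂ}
    (hz : InResolventSet B' z) :
    resolventOp B' z = (incl B).comp (toCLM B B' - z • incl B).inverse :=
  (isResolventAt_inverse hB hB' hz).resolventOp_eq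

theorem isResolventAt_resolventOp [CompleteSpace H] {B : V →ₗ[ℂ] H}
    (hB : (LinearPMap.mk V B).IsClosed) {z : ℂ} (hz : InResolventSet B z) :
    IsResolventAt B z (resolventOp B z) := by
  rw [resolventOp_eq hB hB hz]
  exact isResolventAt_inverse hB hB hz

/-! ## Continuous families -/

section ContinuousFamily

variable {X : Type*} [TopologicalSpace X] {T : Set X} {A : X → V →ₗ[ℂ] H} [CompleteSpace H]

/-- Near `(s, z)` take `A s` as reference; invertible operators form an open set. The parameter
space is merely topological so that the `c^∞`-topology is covered. -/
theorem isOpen_globalResolventSet (hT : IsOpen T)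
    (hA : ∀ t ∈ T, (LinearPMap.mk V (A t)).IsClosed)
    (hcont : ∀ s ∈ T, ContinuousOn (fun t => toCLM (A s) (A t)) T) :
    IsOpen (globalResolventSet T A) := by
  rw [isOpen_iff_mem_nhds]
  rintro ⟨s, z⟩ ⟨hs, hz⟩
  have := completeSpace (hA s hs)
  have hc : ContinuousAt (fun p : X × ℂ => toCLM (A s) (A p.1) - p.2 • incl (A s)) (s, z) := by
    have h1 : ContinuousAt (fun t => toCLM (A s) (A t)) s :=
      (hcont s hs).continuousAt (hT.mem_nhds hs)
    have h2 : ContinuousAt (fun p : X × ℂ => toCLM (A s) (A p.1)) (s, z) :=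
      ContinuousAt.comp (f := fun p : X × ℂ => p.1) (x := (s, z)) h1 continuousAt_fst
    exact h2.sub (by fun_prop)
  obtain ⟨e, he⟩ := (inResolventSet_iff (hA s hs) (hA s hs) z).1 hz
  have h3 := hc.preimage_mem_nhds (by rw [← he]; exact e.nhds)
  filter_upwards [h3, continuousAt_fst.preimage_mem_nhds (hT.mem_nhds hs)] with p hp hpT
  exact ⟨hpT, (inResolventSet_iff (hA s hs) (hA _ hpT) _).2 hp⟩

theorem exists_graphNorm_equiv (hT : IsOpen T)
    (hA : ∀ t ∈ T, (LinearPMap.mk V (A t)).IsClosed)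
    (hcont : ∀ s ∈ T, ContinuousOn (fun t => toCLM (A s) (A t)) T) :
    ∀ s ∈ T, ∀ t₀ ∈ T, ∃ U : Set X, IsOpen U ∧ t₀ ∈ U ∧ U ⊆ T ∧ ∃ C > 0, ∀ t ∈ U, ∀ u : V,
      graphNorm (A t) u ≤ C * graphNorm (A s) u ∧ graphNorm (A s) u ≤ C * graphNorm (A t) u := by
  intro s hs t₀ ht₀
  -- On `U` the graph norms of `A t` and `A t₀` differ by at most half of the latter, so each is at
  -- most twice the other. `C₁` and `C₂` compare `A t₀` with `A s`.
  set U := T ∩ (fun t => toCLM (A t₀) (A t)) ⁻¹' Metric.ball (toCLM (A t₀) (A t₀)) (1 / 2)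
  set C₁ := 1 + ‖toCLM (A s) (A t₀)‖
  set C₂ := 1 + ‖toCLM (A t₀) (A s)‖
  have h₁ : 0 < C₁ := by positivity
  have h₂ : 0 < C₂ := by positivity
  refine ⟨U, (hcont t₀ ht₀).isOpen_inter_preimage hT Metric.isOpen_ball,
    ⟨ht₀, Metric.mem_ball_self (by norm_num)⟩, inter_subset_left, 2 * (C₁ + C₂), by positivity,
    fun t ht u => ?_⟩
  have hd : ‖A t u - A t₀ u‖ ≤ 1 / 2 * graphNorm (A t₀) u := by
    have e : A t u - A t₀ u =
        (toCLM (A t₀) (A t) - toCLM (A t₀) (A t₀)) (of (A t₀) u) := by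
      rw [sub_apply, toCLM_apply (hA _ ht₀) (hA _ ht.1),
        toCLM_apply (hA _ ht₀) (hA _ ht₀)]
    rw [e, ← norm_of]
    refine (ContinuousLinearMap.le_opNorm _ _).trans (mul_le_mul_of_nonneg_right ?_ (norm_nonneg _))
    exact (mem_ball_iff_norm.1 ht.2).le
  have i₁ := graphNorm_le_add_norm_sub (A t) (A t₀) u
  have i₂ := graphNorm_le_add_norm_sub (A t₀) (A t) u
  rw [norm_sub_rev] at i₂
  have j₁ := graphNorm_le (hA s hs) (hA t₀ ht₀) u
  have j₂ := graphNorm_le (hA t₀ ht₀) (hA s hs) u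
  have n₀ := graphNorm_nonneg (A t₀) u
  have n₁ := graphNorm_nonneg (A t) u
  have n₂ := graphNorm_nonneg (A s) u
  constructor
  · calc graphNorm (A t) u ≤ 2 * graphNorm (A t₀) u := by linarith
      _ ≤ 2 * (C₁ * graphNorm (A s) u) := by linarith
      _ ≤ _ := by nlinarith [mul_nonneg h₂.le n₂]
  · calc graphNorm (A s) u ≤ C₂ * graphNorm (A t₀) u := j₂
      _ ≤ C₂ * (2 * graphNorm (A t) u) := mul_le_mul_of_nonneg_left (by linarith) h₂.le
      _ ≤ _ := by nlinarith [mul_nonneg h₁.le n₁]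

end ContinuousFamily

/-! ## Families of class `κ` -/

section ClassFamily

variable {E : Type*} [NormedAddCommGroup E] [NormedSpace ℝ E] [FiniteDimensional ℝ E]
  [CompleteSpace H] {κ : DiffClass}

theorem isOn_toCLM (hκ : κ.Admissible) {T : Set E} (hT : IsOpen T) {A : E → V →ₗ[ℂ] H}
    (hA : ∀ t ∈ T, (LinearPMap.mk V (A t)).IsClosed)
    (hw : ∀ (u : V) (v : H), κ.IsOn (fun t => inner ℂ v (A t u)) T) {B : V →ₗ[ℂ] H}
    (hB : (LinearPMap.mk V B).IsClosed) : κ.IsOn (fun t => toCLM B (A t)) T := by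
  have := completeSpace hB
  refine isNorming_innerFunctional.isOn hκ hT fun p => ?_
  refine (hw ((of B).symm p.1) p.2).congr hT fun t ht => ?_
  simp only [innerFunctional_apply]
  rw [← toCLM_apply hB (hA t ht), LinearEquiv.apply_symm_apply]

/-- The spectral parameter is a function `z` on `O`, so that one statement serves both the pairs
`(t, z)` and smooth curves of such pairs. -/
theorem isOn_resolvent (hκ : κ.Admissible) {O : Set E} (hO : IsOpen O) {A : E → V →ₗ[ℂ] H}
    {z : E → ℂ} {B : V →ₗ[ℂ] H} (hB : (LinearPMap.mk V B).IsClosed)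
    (hA : ∀ t ∈ O, (LinearPMap.mk V (A t)).IsClosed)
    (hA' : κ.IsOn (fun t => toCLM B (A t)) O) (hz : κ.IsOn z O)
    (hr : ∀ t ∈ O, InResolventSet (A t) (z t)) :
    κ.IsOn (fun t => resolventOp (A t) (z t)) O := by
  have := completeSpace hB
  have : ProperSpace E := FiniteDimensional.proper_real E
  let L : ℂ →L[ℝ] GraphSpace B →L[ℂ] H :=
    ((ContinuousLinearMap.toSpanSingleton ℂ (-incl B)).restrictScalars ℝ)
  have h1 : κ.IsOn (fun t => toCLM B (A t) - z t • incl B) O := by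
    refine (hA'.add hκ hO (hz.clm_comp hO L)).congr hO fun t _ => ?_
    simp [L, sub_eq_add_neg]
  have h2 := isOn_inverse hκ hO h1 fun t ht => (inResolventSet_iff hB (hA t ht) _).1 (hr t ht)
  refine (h2.clm_comp hO (compRealL H (GraphSpace B) H (incl B))).congr hO fun t ht => ?_
  simp only [compRealL_apply]
  exact (resolventOp_eq hB (hA t ht) (hr t ht)).symm

end ClassFamily

end GraphOperators

/-! ## Compact resolvents -/

section Compact

variable {H : Type*} [NormedAddCommGroup H] [InnerProductSpace ℂ H]

theorem tendsto_inner_orthonormal {e : ℕ → H} (he : Orthonormal ℂ e) (x : H) :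
    Tendsto (fun n => ‖inner ℂ (e n) x‖) atTop (𝓝 0) := by
  have h := (he.inner_products_summable (x := x)).tendsto_atTop_zero
  have h2 := (Real.continuous_sqrt.tendsto 0).comp h
  simpa [Function.comp_def, Real.sqrt_sq] using h2

/-- Eigenvectors for distinct eigenvalues are independent. After Gram-Schmidt `K` is upper
triangular with diagonal `μ`: `K - μ n` sends the span of the first vectors up to `n` into the span
of those before `n`, which is orthogonal to `e n`. -/
theorem exists_orthonormal_inner_eq {K : H →L[ℂ] H} {μ : ℕ → ℂ} (hμ : Function.Injective μ)
    (h : ∀ n, Module.End.HasEigenvalue (K : H →ₗ[ℂ] H) (μ n)) :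
    ∃ e : ℕ → H, Orthonormal ℂ e ∧ ∀ n, inner ℂ (e n) (K (e n)) = μ n := by
  choose x hx using fun n => (h n).exists_hasEigenvector
  have hli : LinearIndependent ℂ x :=
    Module.End.eigenvectors_linearIndependent' (K : H →ₗ[ℂ] H) μ hμ x hx
  refine ⟨InnerProductSpace.gramSchmidtNormed ℂ x,
    InnerProductSpace.gramSchmidtNormed_orthonormal hli, fun n => ?_⟩
  set e := InnerProductSpace.gramSchmidtNormed ℂ x
  have he : Orthonormal ℂ e := InnerProductSpace.gramSchmidtNormed_orthonormal hli
  have hmem : e n ∈ Submodule.span ℂ (x '' Iic n) := by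
    rw [← InnerProductSpace.span_gramSchmidt_Iic ℂ x n,
      ← InnerProductSpace.span_gramSchmidtNormed x (Iic n)]
    exact Submodule.subset_span (mem_image_of_mem _ self_mem_Iic)
  have hshift : ∀ y ∈ Submodule.span ℂ (x '' Iic n),
      K y - μ n • y ∈ Submodule.span ℂ (e '' Iio n) := by
    intro y hy
    rw [InnerProductSpace.span_gramSchmidtNormed, InnerProductSpace.span_gramSchmidt_Iio]
    induction hy using Submodule.span_induction with
    | mem y hy =>
      obtain ⟨j, hj, rfl⟩ := hy
      have hxj : K (x j) = μ j • x j := (hx j).apply_eq_smul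
      rw [hxj, ← sub_smul]
      rcases (mem_Iic.1 hj).eq_or_lt with rfl | hlt
      · simp
      · exact Submodule.smul_mem _ _ (Submodule.subset_span (mem_image_of_mem _ hlt))
    | zero => simp
    | add y z _ _ hy hz =>
      have : K (y + z) - μ n • (y + z) = (K y - μ n • y) + (K z - μ n • z) := by
        rw [map_add, smul_add]; abel
      rw [this]
      exact Submodule.add_mem _ hy hz
    | smul c y _ hy =>
      have : K (c • y) - μ n • (c • y) = c • (K y - μ n • y) := by
        rw [map_smul, smul_sub, smul_comm]
      rw [this]
      exact Submodule.smul_mem _ _ hy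
  have hperp : ∀ y ∈ Submodule.span ℂ (e '' Iio n), inner ℂ (e n) y = 0 := by
    intro y hy
    induction hy using Submodule.span_induction with
    | mem y hy =>
      obtain ⟨j, hj, rfl⟩ := hy
      exact he.2 (mem_Iio.1 hj).ne'
    | zero => simp
    | add y z _ _ hy hz => rw [inner_add_right, hy, hz, add_zero]
    | smul c y _ hy => rw [inner_smul_right, hy, mul_zero]
  have h1 := hperp _ (hshift _ hmem)
  rw [inner_sub_right, inner_smul_right, inner_self_eq_norm_sq_to_K, he.1 n] at h1
  simpa [sub_eq_zero] using h1

/-- Infinitely many would give an orthonormal `e` with `‖⟪e n, K (e n)⟫‖ > ε`. Compactness makes `K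
(e n)` converge along a subsequence, and by Bessel these inner products tend to 0. -/
theorem finite_eigenvalues_of_lt_norm {K : H →L[ℂ] H} (hK : IsCompactOperator K) {ε : ℝ}
    (hε : 0 < ε) :
    {μ : ℂ | Module.End.HasEigenvalue (K : H →ₗ[ℂ] H) μ ∧ ε < ‖μ‖}.Finite := by
  by_contra hinf
  have hinf' : Set.Infinite {μ : ℂ | Module.End.HasEigenvalue (K : H →ₗ[ℂ] H) μ ∧ ε < ‖μ‖} := hinf
  set ν := hinf'.natEmbedding
  have hν : Function.Injective fun n => (ν n : ℂ) := Subtype.val_injective.comp ν.injective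
  obtain ⟨e, he, heν⟩ := exists_orthonormal_inner_eq (K := K) hν fun n => (ν n).2.1
  have hc := hK.isCompact_closure_image_closedBall 1
  obtain ⟨w, -, φ, hφ, hw⟩ := hc.tendsto_subseq (x := fun n => K (e n)) fun n =>
    subset_closure (mem_image_of_mem _ (by simp [he.1 n]))
  have h1 : Tendsto (fun n => ‖inner ℂ (e (φ n)) w‖ + ‖K (e (φ n)) - w‖) atTop (𝓝 (0 + 0)) :=
    ((tendsto_inner_orthonormal he w).comp hφ.tendsto_atTop).add
      (tendsto_iff_norm_sub_tendsto_zero.1 hw)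
  rw [add_zero] at h1
  refine absurd (ge_of_tendsto' h1 fun n => ?_) (not_le.2 hε)
  calc ε ≤ ‖(ν (φ n) : ℂ)‖ := (ν (φ n)).2.2.le
    _ = ‖inner ℂ (e (φ n)) w + inner ℂ (e (φ n)) (K (e (φ n)) - w)‖ := by
      rw [← inner_add_right, add_sub_cancel, heν]
    _ ≤ ‖inner ℂ (e (φ n)) w‖ + ‖inner ℂ (e (φ n)) (K (e (φ n)) - w)‖ := norm_add_le _ _
    _ ≤ _ := by
      gcongr
      refine (norm_inner_le_norm (𝕜 := ℂ) (e (φ n)) (K (e (φ n)) - w)).trans_eq ?_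
      rw [he.1, one_mul]

theorem countable_spectrum [CompleteSpace H] {K : H →L[ℂ] H} (hK : IsCompactOperator K) :
    (spectrum ℂ K).Countable := by
  have hsub : spectrum ℂ K ⊆ {0} ∪ ⋃ n : ℕ,
      {μ : ℂ | Module.End.HasEigenvalue (K : H →ₗ[ℂ] H) μ ∧ 1 / ((n : ℝ) + 1) < ‖μ‖} := by
    intro μ hμ
    rcases eq_or_ne μ 0 with rfl | h0
    · exact Or.inl rfl
    · obtain ⟨n, hn⟩ := exists_nat_one_div_lt (norm_pos_iff.2 h0)
      exact Or.inr (mem_iUnion.2 ⟨n, (hK.hasEigenvalue_iff_mem_spectrum h0).2 hμ, hn⟩)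
  exact ((countable_singleton 0).union (countable_iUnion fun n =>
    (finite_eigenvalues_of_lt_norm hK (by positivity)).countable)).mono hsub

variable [CompleteSpace H] {V : Submodule ℂ H}

/-- The factorisation `B - z = (z - z₀) ((z - z₀)⁻¹ - K) (B - z₀)` sends the points outside the
resolvent set into the countable spectrum of `K`. -/
theorem countable_compl_resolventSet {B : V →ₗ[ℂ] H} (hB : (LinearPMap.mk V B).IsClosed)
    (hc : HasCompactResolvent B) : {z | InResolventSet B z}ᶜ.Countable := by
  obtain ⟨z₀, hz₀, hK⟩ := hc
  set K := resolventOp B z₀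
  have hR : IsResolventAt B z₀ K := isResolventAt_resolventOp hB hz₀
  refine ((countable_spectrum hK).image fun μ => z₀ + μ⁻¹).mono fun z hz => ?_
  refine ⟨(z - z₀)⁻¹, ?_, by simp⟩
  by_contra hns
  apply hz
  rcases eq_or_ne z z₀ with rfl | hne
  · exact hz₀
  have hc : z - z₀ ≠ 0 := sub_ne_zero.2 hne
  have hu : IsUnit (algebraMap ℂ (H →L[ℂ] H) (z - z₀)⁻¹ - K) := spectrum.notMem_iff.1 hns
  have hbij : Function.Bijective fun x : H => (z - z₀)⁻¹ • x - K x := by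
    have h1 := ContinuousLinearMap.isUnit_iff_bijective.1 hu
    have h2 : ⇑(algebraMap ℂ (H →L[ℂ] H) (z - z₀)⁻¹ - K) = fun x : H => (z - z₀)⁻¹ • x - K x := by
      ext x; simp [Algebra.algebraMap_eq_smul_one]
    rwa [h2] at h1
  have hcomp : (fun u : V => B u - z • (u : H)) =
      (fun x : H => (z - z₀) • x) ∘ (fun x : H => (z - z₀)⁻¹ • x - K x) ∘
        fun u : V => B u - z₀ • (u : H) := by
    ext u
    simp only [Function.comp_apply]
    rw [hR.1 u, smul_sub, smul_smul, mul_inv_cancel₀ hc, one_smul, sub_smul]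
    abel
  change Function.Bijective _
  rw [hcomp]
  exact (MulAction.bijective (Units.mk0 _ hc)).comp (hbij.comp hz₀)

theorem isPathConnected_resolventSet {B : V →ₗ[ℂ] H} (hB : (LinearPMap.mk V B).IsClosed)
    (hc : HasCompactResolvent B) : IsPathConnected {z | InResolventSet B z} := by
  have := (countable_compl_resolventSet hB hc).isPathConnected_compl_of_one_lt_rank
    (by rw [Complex.rank_real_complex]; exact Cardinal.one_lt_two)
  rwa [compl_compl] at this

end Compact

/-! ## Connectedness of the global resolvent set -/

/-- The topology `σ` need not be the product topology, which allows the `c^∞`-topology of `E × ℂ`;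
only horizontal slices and vertical real lines are assumed continuous. -/
theorem isConnected_of_fibers {X : Type*} [τ : TopologicalSpace X] [σ : TopologicalSpace (X × ℂ)]
    {T : Set X} (hT : IsConnected T) {R : Set (X × ℂ)}
    (hslice : ∀ z : ℂ, Continuous fun t : X => (t, z))
    (hcurve : ∀ (t : X) (z w : ℂ), Continuous fun r : ℝ => (t, z + (r : ℂ) * w))
    (hTR : ∀ p ∈ R, p.1 ∈ T) (hR : IsOpen R)
    (hfo : ∀ t ∈ T, IsOpen {z | (t, z) ∈ R}) (hfc : ∀ t ∈ T, IsConnected {z | (t, z) ∈ R}) :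
    IsConnected R := by
  choose! ζ hζ using fun t ht => (hfc t ht).nonempty
  obtain ⟨t₁, ht₁⟩ := hT.nonempty
  refine ⟨⟨(t₁, ζ t₁), hζ t₁ ht₁⟩, isPreconnected_of_forall_constant fun f hf => ?_⟩
  have hfib : ∀ t ∈ T, ∀ z ∈ {z | (t, z) ∈ R}, ∀ w ∈ {z | (t, z) ∈ R}, f (t, z) = f (t, w) := by
    intro t ht z hz w hw
    refine (hfc t ht).isPreconnected.constant (f := fun z => f (t, z)) ?_ hz hw
    intro z hz
    obtain ⟨ε, hε, hball⟩ := Metric.isOpen_iff.1 (hfo t ht) z hz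
    refine ContinuousAt.continuousWithinAt
      ((continuousAt_const (y := f (t, z))).congr (Filter.mem_of_superset (Metric.ball_mem_nhds z hε) fun w hw => ?_))
    -- Segments within the fibre show that `f` is locally constant on it, using continuity along
    -- real lines only.
    have hmaps : MapsTo (fun r : ℝ => (t, z + (r : ℂ) * (w - z))) (Icc 0 1) R := by
      intro r hr
      refine hball ?_
      rw [mem_ball_iff_norm, add_sub_cancel_left, norm_mul, Complex.norm_real,
        Real.norm_of_nonneg hr.1]
      exact (mul_le_of_le_one_left (norm_nonneg _) hr.2).trans_lt (mem_ball_iff_norm.1 hw)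
    have := isPreconnected_Icc.constant (hf.comp (hcurve t z (w - z)).continuousOn hmaps)
      (left_mem_Icc.2 zero_le_one) (right_mem_Icc.2 zero_le_one)
    simpa using this
  -- The choice `ζ` may be discontinuous, but near `t₀` constancy on fibres allows `ζ t` to be
  -- replaced by `ζ t₀`.
  have hg : ContinuousOn (fun t => f (t, ζ t)) T := by
    intro t₀ ht₀
    have h1 : ContinuousAt (fun t => f (t, ζ t₀)) t₀ :=
      ContinuousAt.comp (f := fun t => (t, ζ t₀)) (x := t₀)
        (hf.continuousAt (hR.mem_nhds (hζ t₀ ht₀))) (hslice (ζ t₀)).continuousAt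
    refine (h1.congr ?_).continuousWithinAt
    filter_upwards [(hslice (ζ t₀)).continuousAt.preimage_mem_nhds (hR.mem_nhds (hζ t₀ ht₀))]
      with t ht
    exact hfib t (hTR _ ht) _ ht _ (hζ t (hTR _ ht))
  rintro ⟨t, z⟩ htz ⟨t', z'⟩ htz'
  have ht : t ∈ T := hTR _ htz
  have ht' : t' ∈ T := hTR _ htz'
  rw [hfib t ht z htz _ (hζ t ht), hfib t' ht' z' htz' _ (hζ t' ht')]
  exact hT.isPreconnected.constant hg ht ht'

/-! ## Smooth curves -/

section Curves

variable {E : Type*} [AddCommGroup E] [Module ℝ E] [TopologicalSpace E]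

/-- `g'` is the derivative of the curve `g`. -/
def HasCurveDeriv (g g' : ℝ → E) : Prop :=
  ∀ s, Tendsto (fun r => (r - s)⁻¹ • (g r - g s)) (𝓝[≠] s) (𝓝 (g' s))

theorem isSmoothCurve_of_mem {S : Set (ℝ → E)} (h : ∀ g ∈ S, ∃ g' ∈ S, HasCurveDeriv g g')
    {c : ℝ → E} (hc : c ∈ S) : IsSmoothCurve c := by
  choose! d hd using h
  refine ⟨fun n => d^[n] c, rfl, fun n => ?_⟩
  have hmem : ∀ n, d^[n] c ∈ S := fun n => by
    induction n with
    | zero => exact hc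
    | succ n ih => rw [Function.iterate_succ_apply']; exact (hd _ ih).1
  have := (hd _ (hmem n)).2
  rw [← Function.iterate_succ_apply' d n c] at this
  exact this

theorem HasCurveDeriv.add [IsTopologicalAddGroup E] {g g' k k' : ℝ → E} (hg : HasCurveDeriv g g')
    (hk : HasCurveDeriv k k') : HasCurveDeriv (g + k) (g' + k') := fun s =>
  ((hg s).add (hk s)).congr fun r => by
    simp only [Pi.add_apply]; rw [← smul_add]; congr 1; abel

theorem HasCurveDeriv.const_smul [ContinuousSMul ℝ E] {g g' : ℝ → E} (hg : HasCurveDeriv g g')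
    (a : ℝ) : HasCurveDeriv (a • g) (a • g') := fun s =>
  ((hg s).const_smul a).congr fun r => by
    simp only [Pi.smul_apply]; rw [← smul_sub, smul_comm]

theorem hasCurveDeriv_const (x : E) : HasCurveDeriv (fun _ => x) 0 := fun s => by
  simpa using tendsto_const_nhds

theorem hasCurveDeriv_of_hasDerivAt {F : Type*} [NormedAddCommGroup F] [NormedSpace ℝ F]
    {g g' : ℝ → F} (h : ∀ s, HasDerivAt g (g' s) s) : HasCurveDeriv g g' := fun s =>
  hasDerivAt_iff_tendsto_slope.1 (h s)

theorem HasCurveDeriv.hasDerivAt {F : Type*} [NormedAddCommGroup F] [NormedSpace ℝ F]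
    {g g' : ℝ → F} (h : HasCurveDeriv g g') (s : ℝ) : HasDerivAt g (g' s) s :=
  hasDerivAt_iff_tendsto_slope.2 (h s)

theorem HasCurveDeriv.prodMk {F : Type*} [AddCommGroup F] [Module ℝ F] [TopologicalSpace F]
    {g g' : ℝ → E} {k k' : ℝ → F} (hg : HasCurveDeriv g g') (hk : HasCurveDeriv k k') :
    HasCurveDeriv (fun s => (g s, k s)) (fun s => (g' s, k' s)) := fun s =>
  (hg s).prodMk_nhds (hk s)

section Reparametrization

variable [IsTopologicalAddGroup E] [ContinuousSMul ℝ E]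

theorem HasCurveDeriv.continuous {g g' : ℝ → E} (h : HasCurveDeriv g g') : Continuous g := by
  refine continuous_iff_continuousAt.2 fun s => ?_
  rw [continuousAt_iff_punctured_nhds]
  have h1 : Tendsto (fun r : ℝ => r - s) (𝓝[≠] s) (𝓝 0) := by
    have : ContinuousAt (fun r : ℝ => r - s) s := by fun_prop
    simpa using this.tendsto.mono_left nhdsWithin_le_nhds
  have h2 := (h1.smul (h s)).add_const (g s)
  rw [zero_smul, zero_add] at h2
  refine h2.congr' ?_
  filter_upwards [self_mem_nhdsWithin] with r hr
  rw [smul_smul, mul_inv_cancel₀ (sub_ne_zero.2 hr), one_smul, sub_add_cancel]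

omit [IsTopologicalAddGroup E] in
theorem HasCurveDeriv.comp {g g' : ℝ → E} (h : HasCurveDeriv g g') {φ φ' : ℝ → ℝ}
    (hφ : HasCurveDeriv φ φ') : HasCurveDeriv (g ∘ φ) (fun s => φ' s • g' (φ s)) := by
  intro s
  -- Filling in the difference quotient by the derivative covers the parameters `r` with `φ r = φ
  -- s`.
  set Q := Function.update (fun x => (x - φ s)⁻¹ • (g x - g (φ s))) (φ s) (g' (φ s))
  have hQ : ContinuousAt Q (φ s) := continuousAt_update_same.2 (h (φ s))
  have hQφ : Tendsto (fun r => Q (φ r)) (𝓝[≠] s) (𝓝 (g' (φ s))) := by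
    have h1 : ContinuousAt (fun r => Q (φ r)) s :=
      ContinuousAt.comp (f := φ) hQ hφ.continuous.continuousAt
    have h2 := h1.tendsto.mono_left (nhdsWithin_le_nhds (s := {s}ᶜ))
    simpa [Q] using h2
  refine ((hφ s).smul hQφ).congr fun r => ?_
  rcases eq_or_ne (φ r) (φ s) with he | hne
  · simp [he]
  · simp only [Q, Function.comp_apply, Function.update_of_ne hne, smul_eq_mul, smul_smul]
    rw [mul_assoc, mul_inv_cancel₀ (sub_ne_zero.2 hne), mul_one]

theorem HasCurveDeriv.smul {g g' : ℝ → E} (h : HasCurveDeriv g g') {a a' : ℝ → ℝ}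
    (ha : HasCurveDeriv a a') :
    HasCurveDeriv (fun s => a s • g s) ((fun s => a' s • g s) + fun s => a s • g' s) := by
  intro s
  have h1 : Tendsto g (𝓝[≠] s) (𝓝 (g s)) :=
    h.continuous.continuousAt.tendsto.mono_left nhdsWithin_le_nhds
  refine (((ha s).smul h1).add ((h s).const_smul (a s))).congr fun r => ?_
  rw [smul_comm (a s), smul_assoc, ← smul_add]
  congr 1
  rw [smul_sub, sub_smul]
  abel

/-- The span of the curves `a • (D j ∘ φ)` with `a` smooth is closed under differentiation, so no
formula for higher derivatives is needed. -/
theorem IsSmoothCurve.comp {c : ℝ → E} (hc : IsSmoothCurve c) {φ : ℝ → ℝ}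
    (hφ : ContDiff ℝ ∞ φ) : IsSmoothCurve (c ∘ φ) := by
  obtain ⟨D, rfl, hD⟩ := hc
  have hderiv : ∀ a : ℝ → ℝ, ContDiff ℝ ∞ a → ContDiff ℝ ∞ (deriv a) ∧
      HasCurveDeriv a (deriv a) := fun a ha => by
    have h1 := contDiff_infty_iff_deriv.1 ha
    exact ⟨h1.2, hasCurveDeriv_of_hasDerivAt fun s => (h1.1 s).hasDerivAt⟩
  set G : Set (ℝ → E) := {g | ∃ a : ℝ → ℝ, ContDiff ℝ ∞ a ∧ ∃ j, g = fun s => a s • D j (φ s)}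
  refine isSmoothCurve_of_mem (S := (Submodule.span ℝ G : Set (ℝ → E))) (fun g hg => ?_)
    (Submodule.subset_span ⟨fun _ => 1, contDiff_const, 0, by ext s; simp⟩)
  induction hg using Submodule.span_induction with
  | mem g hg =>
    obtain ⟨a, ha, j, rfl⟩ := hg
    have h1 : HasCurveDeriv (D j ∘ φ) (fun s => deriv φ s • D (j + 1) (φ s)) :=
      HasCurveDeriv.comp (hD j) (hderiv φ hφ).2
    refine ⟨_, Submodule.add_mem _ (Submodule.subset_span ⟨deriv a, (hderiv a ha).1, j, rfl⟩)
      (Submodule.subset_span ⟨fun s => a s * deriv φ s, ha.mul (hderiv φ hφ).1, j + 1, rfl⟩), ?_⟩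
    have h2 := h1.smul (hderiv a ha).2
    simp only [smul_smul] at h2
    exact h2
  | zero => exact ⟨0, Submodule.zero_mem _, hasCurveDeriv_const 0⟩
  | add g k _ _ hg hk =>
    obtain ⟨g', hg', hg⟩ := hg
    obtain ⟨k', hk', hk⟩ := hk
    exact ⟨_, Submodule.add_mem _ hg' hk', hg.add hk⟩
  | smul a g _ hg =>
    obtain ⟨g', hg', hg⟩ := hg
    exact ⟨_, Submodule.smul_mem _ a hg', hg.const_smul a⟩

end Reparametrization

theorem IsSmoothCurve.contDiff {F : Type*} [NormedAddCommGroup F] [NormedSpace ℝ F] {c : ℝ → F}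
    (hc : IsSmoothCurve c) : ContDiff ℝ ∞ c := by
  obtain ⟨D, rfl, hD⟩ := hc
  have h : ∀ n : ℕ, ∀ j, ContDiff ℝ n (D j) := by
    intro n
    induction n with
    | zero =>
      intro j
      exact contDiff_zero.2 (HasCurveDeriv.continuous (hD j))
    | succ n ih =>
      intro j
      have h1 : ∀ s, HasDerivAt (D j) (D (j + 1) s) s := HasCurveDeriv.hasDerivAt (hD j)
      have h2 : deriv (D j) = D (j + 1) := funext fun s => (h1 s).deriv
      exact_mod_cast (contDiff_succ_iff_deriv (n := (n : WithTop ℕ∞))).2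
        ⟨fun s => (h1 s).differentiableAt, by simp, by rw [h2]; exact ih (j + 1)⟩
  exact contDiff_infty.2 fun n => h n 0

theorem isSmoothCurve_of_contDiff {F : Type*} [NormedAddCommGroup F] [NormedSpace ℝ F] {c : ℝ → F}
    (hc : ContDiff ℝ ∞ c) : IsSmoothCurve c :=
  isSmoothCurve_of_mem (S := {g | ContDiff ℝ ∞ g}) (fun g hg => ⟨deriv g,
    (contDiff_infty_iff_deriv.1 hg).2, hasCurveDeriv_of_hasDerivAt fun s =>
      ((contDiff_infty_iff_deriv.1 hg).1 s).hasDerivAt⟩) hc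

section Prod

variable {F : Type*} [AddCommGroup F] [Module ℝ F] [TopologicalSpace F]

theorem IsSmoothCurve.fst {c : ℝ → E × F} (hc : IsSmoothCurve c) :
    IsSmoothCurve fun s => (c s).1 := by
  obtain ⟨D, rfl, hD⟩ := hc
  exact ⟨fun n s => (D n s).1, rfl, fun n s => (continuous_fst.tendsto _).comp (hD n s)⟩

theorem IsSmoothCurve.snd {c : ℝ → E × F} (hc : IsSmoothCurve c) :
    IsSmoothCurve fun s => (c s).2 := by
  obtain ⟨D, rfl, hD⟩ := hc
  exact ⟨fun n s => (D n s).2, rfl, fun n s => (continuous_snd.tendsto _).comp (hD n s)⟩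

theorem IsSmoothCurve.prodMk {c : ℝ → E} {d : ℝ → F} (hc : IsSmoothCurve c)
    (hd : IsSmoothCurve d) : IsSmoothCurve fun s => (c s, d s) := by
  obtain ⟨D, rfl, hD⟩ := hc
  obtain ⟨D', rfl, hD'⟩ := hd
  exact ⟨fun n s => (D n s, D' n s), rfl, fun n => HasCurveDeriv.prodMk (hD n) (hD' n)⟩

theorem isSmoothCurve_const (x : E) : IsSmoothCurve fun _ => x :=
  isSmoothCurve_of_mem (S := range fun x : E => fun _ : ℝ => x) (by
    rintro _ ⟨x, rfl⟩
    exact ⟨0, ⟨0, rfl⟩, hasCurveDeriv_const x⟩) ⟨x, rfl⟩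

end Prod

/-! ## The `c^∞`-topology -/

theorem isOpen_cInfty_iff {U : Set E} :
    IsOpen[cInftyTopology E] U ↔ ∀ c : ℝ → E, IsSmoothCurve c → IsOpen (c ⁻¹' U) := by
  simp only [isOpen_iSup_iff, isOpen_coinduced, Subtype.forall]

theorem IsSmoothCurve.continuous_cInfty {c : ℝ → E} (hc : IsSmoothCurve c) :
    @Continuous ℝ E _ (cInftyTopology E) c :=
  @Continuous.mk ℝ E _ (cInftyTopology E) c fun _ hU => isOpen_cInfty_iff.1 hU c hc

theorem continuousOn_cInfty [IsTopologicalAddGroup E] [ContinuousSMul ℝ E] {Y : Type*}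
    [TopologicalSpace Y] {f : E → Y} {T : Set E} (hT : IsOpen[cInftyTopology E] T)
    (hf : ∀ c : ℝ → E, IsSmoothCurve c → (∀ s, c s ∈ T) → Continuous fun s => f (c s)) :
    @ContinuousOn E Y (cInftyTopology E) _ f T := by
  refine (@continuousOn_open_iff E Y (cInftyTopology E) _ f T hT).2 fun O hO => ?_
  rw [isOpen_cInfty_iff]
  intro c hc
  rw [isOpen_iff_mem_nhds]
  rintro s₀ ⟨hs₀, hO₀⟩
  obtain ⟨δ, hδ, hball⟩ := Metric.isOpen_iff.1 (isOpen_cInfty_iff.1 hT c hc) s₀ hs₀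
  -- The hypothesis concerns curves lying wholly in `T`. This reparametrisation confines `c` to `T`,
  -- and its nonzero derivative at 0 makes it carry neighbourhoods of 0 onto neighbourhoods of `s₀`.
  set φ : ℝ → ℝ := fun r => s₀ + δ / 2 * Real.sin r
  have hφs : ContDiff ℝ ∞ φ := contDiff_const.add (contDiff_const.mul Real.contDiff_sin)
  have hφ0 : φ 0 = s₀ := by simp [φ]
  have hφd : HasStrictDerivAt φ (δ / 2) 0 := by
    have h1 := ((Real.hasStrictDerivAt_sin 0).const_mul (δ / 2)).const_add s₀
    simpa [φ] using h1
  have hmem : ∀ r, c (φ r) ∈ T := fun r => hball (by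
    rw [mem_ball_iff_norm, add_sub_cancel_left, norm_mul, Real.norm_of_nonneg (by positivity)]
    have := Real.abs_sin_le_one r
    rw [Real.norm_eq_abs]
    nlinarith)
  have hcont := hf _ (hc.comp hφs) hmem
  have hev : ∀ᶠ r in 𝓝 0, c (φ r) ∈ T ∩ f ⁻¹' O := by
    have h0 : f ((c ∘ φ) 0) ∈ O := by rw [Function.comp_apply, hφ0]; exact hO₀
    filter_upwards [hcont.continuousAt.preimage_mem_nhds (hO.mem_nhds h0)] with r hr
    exact ⟨hmem r, hr⟩
  have hmap := hφd.map_nhds_eq (by positivity)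
  rw [hφ0] at hmap
  rw [← hmap]
  exact hev

theorem isOpen_cInfty_prod {F : Type*} [NormedAddCommGroup F] [NormedSpace ℝ F] {U : Set (E × F)}
    (hU : IsOpen[@instTopologicalSpaceProd E F (cInftyTopology E) inferInstance] U) :
    IsOpen[cInftyTopology (E × F)] U := by
  rw [isOpen_cInfty_iff]
  intro c hc
  have h1 := hc.fst.continuous_cInfty
  have h2 : Continuous fun s => (c s).2 := hc.snd.contDiff.continuous
  have h3 := @Continuous.prodMk E F ℝ (cInftyTopology E) _ _ _ _ h1 h2
  exact @IsOpen.preimage ℝ (E × F) _ (@instTopologicalSpaceProd E F (cInftyTopology E) _) _ h3 _ hU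

theorem continuous_cInfty_prodMk {F : Type*} [NormedAddCommGroup F] [NormedSpace ℝ F] (z : F) :
    @Continuous E (E × F) (cInftyTopology E) (cInftyTopology (E × F)) fun t => (t, z) :=
  @Continuous.mk E (E × F) (cInftyTopology E) (cInftyTopology (E × F)) _ fun _ hU =>
    isOpen_cInfty_iff.2 fun _ hc =>
      isOpen_cInfty_iff.1 hU _ (hc.prodMk (isSmoothCurve_const z))

/-- Needed for the `z`-component of a curve in the resolvent set; smooth curves need not be analytic
or of a given Denjoy-Carleman class. -/
theorem isOn_curve {κ : DiffClass} (hκ : κ.Admissible) (h : κ = .smooth ∨ ∃ α, κ = .holder α)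
    {F : Type*} [NormedAddCommGroup F] [NormedSpace ℝ F] {c : ℝ → F} (hc : ContDiff ℝ ∞ c) :
    κ.IsOn c univ := by
  rcases h with rfl | ⟨α, rfl⟩
  · exact hc.contDiffOn
  · refine DiffClass.isOn_holder_of_lipschitz hκ fun K _ hK => ?_
    have h1 : LocallyLipschitz c := (hc.of_le (m := 1) ENat.LEInfty.out).locallyLipschitz
    obtain ⟨C, hC⟩ := (h1.locallyLipschitzOn (s := K)).exists_lipschitzOnWith_of_compact hK
    exact ⟨C, fun x hx y hy => by simpa [dist_eq_norm] using hC.dist_le_mul x hx y hy⟩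

end Curves

/-! ## The two parameter settings -/

open GraphSpace

theorem DiffClass.isOn_empty {E F : Type*} [NormedAddCommGroup E] [NormedSpace ℝ E]
    [NormedAddCommGroup F] [NormedSpace ℝ F] {κ : DiffClass} (hκ : κ.Admissible) (f : E → F) :
    κ.IsOn f ∅ :=
  (DiffClass.isOn_clm hκ (0 : E →L[ℝ] F) ∅).congr isOpen_empty (eqOn_empty _ _)

section

variable {H : Type*} [NormedAddCommGroup H] [InnerProductSpace ℂ H] [CompleteSpace H]
  {V : Submodule ℂ H}

theorem isConnected_setOf_mem_globalResolventSet {E : Type*} {T : Set E} {A : E → V →ₗ[ℂ] H}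
    (hA : ∀ t ∈ T, (LinearPMap.mk V (A t)).IsClosed)
    (hc : ∀ t ∈ T, HasCompactResolvent (A t)) (t : E) (ht : t ∈ T) :
    IsConnected {z : ℂ | (t, z) ∈ globalResolventSet T A} := by
  have e : {z : ℂ | (t, z) ∈ globalResolventSet T A} = {z | InResolventSet (A t) z} := by
    ext z; exact and_iff_right ht
  rw [e]
  exact (isPathConnected_resolventSet (hA t ht) (hc t ht)).isConnected

section FiniteDimensional

variable {E : Type*} [NormedAddCommGroup E] [NormedSpace ℝ E] [FiniteDimensional ℝ E]
  {T : Set E} {κ : DiffClass} {A : E → V →ₗ[ℂ] H}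

theorem continuousOn_toCLM (hκ : κ.Admissible) (hT : IsOpen T)
    (hA : ∀ t ∈ T, (LinearPMap.mk V (A t)).IsClosed)
    (hw : ∀ (u : V) (v : H), κ.IsOn (fun t => inner ℂ v (A t u)) T) (s : E) (hs : s ∈ T) :
    ContinuousOn (fun t => toCLM (A s) (A t)) T := by
  have : ProperSpace E := FiniteDimensional.proper_real E
  exact (isOn_toCLM hκ hT hA hw (hA s hs)).continuousOn hκ hT

theorem isOn_resolventOp (hκ : κ.Admissible) (hT : IsOpen T)
    (hA : ∀ t ∈ T, (LinearPMap.mk V (A t)).IsClosed)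
    (hw : ∀ (u : V) (v : H), κ.IsOn (fun t => inner ℂ v (A t u)) T) :
    κ.IsOn (fun p : E × ℂ => resolventOp (A p.1) p.2) (globalResolventSet T A) := by
  -- A point of the resolvent set supplies the reference operator `A s`.
  rcases (globalResolventSet T A).eq_empty_or_nonempty with he | ⟨⟨s, z⟩, hs, -⟩
  · rw [he]; exact DiffClass.isOn_empty hκ _
  have hR := isOpen_globalResolventSet hT hA (continuousOn_toCLM hκ hT hA hw)
  have h1 := (isOn_toCLM hκ hT hA hw (hA s hs)).comp_clm hκ hT (ContinuousLinearMap.fst ℝ E ℂ)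
  exact isOn_resolvent (A := fun p : E × ℂ => A p.1) (z := fun p => p.2) hκ hR (hA s hs)
    (fun p hp => hA _ hp.1) (h1.mono fun p hp => hp.1)
    (DiffClass.isOn_clm hκ (ContinuousLinearMap.snd ℝ E ℂ) _) fun p hp => hp.2

theorem isConnected_globalResolventSet (hκ : κ.Admissible) (hT : IsOpen T)
    (hA : ∀ t ∈ T, (LinearPMap.mk V (A t)).IsClosed)
    (hw : ∀ (u : V) (v : H), κ.IsOn (fun t => inner ℂ v (A t u)) T) (hTc : IsConnected T)
    (hc : ∀ t ∈ T, HasCompactResolvent (A t)) : IsConnected (globalResolventSet T A) := by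
  have hR := isOpen_globalResolventSet hT hA (continuousOn_toCLM hκ hT hA hw)
  exact isConnected_of_fibers hTc (fun z => by fun_prop) (fun t z w => by fun_prop)
    (fun p hp => hp.1) hR (fun t _ => hR.preimage (by fun_prop : Continuous fun z : ℂ => (t, z)))
    (isConnected_setOf_mem_globalResolventSet hA hc)

end FiniteDimensional

section Convenient

variable {E : Type*} [AddCommGroup E] [Module ℝ E] [TopologicalSpace E]
  {T : Set E} {κ : DiffClass} {A : E → V →ₗ[ℂ] H}

theorem isAlongCurves_toCLM (hκ : κ.Admissible)
    (hA : ∀ t ∈ T, (LinearPMap.mk V (A t)).IsClosed)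
    (hw : ∀ (u : V) (v : H), κ.IsAlongCurves (fun t => inner ℂ v (A t u)) T) {B : V →ₗ[ℂ] H}
    (hB : (LinearPMap.mk V B).IsClosed) : κ.IsAlongCurves (fun t => toCLM B (A t)) T :=
  fun c hc hcT => isOn_toCLM (A := fun s => A (c s)) hκ isOpen_univ (fun s _ => hA _ (hcT s))
    (fun u v => hw u v c hc hcT) hB

theorem isAlongCurves_resolventOp (hκ : κ.Admissible)
    (hκ' : κ = .smooth ∨ ∃ α, κ = .holder α)
    (hA : ∀ t ∈ T, (LinearPMap.mk V (A t)).IsClosed)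
    (hw : ∀ (u : V) (v : H), κ.IsAlongCurves (fun t => inner ℂ v (A t u)) T) :
    κ.IsAlongCurves (fun p : E × ℂ => resolventOp (A p.1) p.2) (globalResolventSet T A) := by
  intro c hc hcR
  have h0 := hA _ (hcR 0).1
  exact isOn_resolvent (A := fun s => A (c s).1) (z := fun s => (c s).2) hκ isOpen_univ h0
    (fun s _ => hA _ (hcR s).1)
    (isAlongCurves_toCLM hκ hA hw h0 _ hc.fst fun s => (hcR s).1)
    (isOn_curve hκ hκ' hc.snd.contDiff) fun s _ => (hcR s).2

variable [IsTopologicalAddGroup E] [ContinuousSMul ℝ E]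

theorem continuousOn_cInfty_toCLM (hκ : κ.Admissible) (hT : IsOpen[cInftyTopology E] T)
    (hA : ∀ t ∈ T, (LinearPMap.mk V (A t)).IsClosed)
    (hw : ∀ (u : V) (v : H), κ.IsAlongCurves (fun t => inner ℂ v (A t u)) T) (s : E)
    (hs : s ∈ T) :
    @ContinuousOn E _ (cInftyTopology E) _ (fun t => toCLM (A s) (A t)) T :=
  continuousOn_cInfty hT fun c hc hcT => continuousOn_univ.1
    ((isAlongCurves_toCLM hκ hA hw (hA s hs) c hc hcT).continuousOn hκ isOpen_univ)

theorem isOpen_prod_globalResolventSet (hκ : κ.Admissible) (hT : IsOpen[cInftyTopology E] T)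
    (hA : ∀ t ∈ T, (LinearPMap.mk V (A t)).IsClosed)
    (hw : ∀ (u : V) (v : H), κ.IsAlongCurves (fun t => inner ℂ v (A t u)) T) :
    IsOpen[@instTopologicalSpaceProd E ℂ (cInftyTopology E) inferInstance]
      (globalResolventSet T A) :=
  @isOpen_globalResolventSet H _ _ V E (cInftyTopology E) T A _ hT hA
    (continuousOn_cInfty_toCLM hκ hT hA hw)

theorem isConnected_cInfty_globalResolventSet (hκ : κ.Admissible)
    (hT : IsOpen[cInftyTopology E] T) (hA : ∀ t ∈ T, (LinearPMap.mk V (A t)).IsClosed)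
    (hw : ∀ (u : V) (v : H), κ.IsAlongCurves (fun t => inner ℂ v (A t u)) T)
    (hTc : @IsConnected E (cInftyTopology E) T) (hc : ∀ t ∈ T, HasCompactResolvent (A t)) :
    @IsConnected (E × ℂ) (cInftyTopology (E × ℂ)) (globalResolventSet T A) := by
  have hR := isOpen_prod_globalResolventSet hκ hT hA hw
  have hcurve : ∀ (t : E) (z w : ℂ), IsSmoothCurve fun r : ℝ => (t, z + (r : ℂ) * w) :=
    fun t z w => (isSmoothCurve_const t).prodMk (isSmoothCurve_of_contDiff
      (contDiff_const.add (Complex.ofRealCLM.contDiff.mul contDiff_const)))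
  refine @isConnected_of_fibers E (cInftyTopology E) (cInftyTopology (E × ℂ)) T hTc _
    continuous_cInfty_prodMk (fun t z w => (hcurve t z w).continuous_cInfty)
    (fun p hp => hp.1) (isOpen_cInfty_prod hR) (fun t _ => ?_)
    (isConnected_setOf_mem_globalResolventSet hA hc)
  have h : @Continuous ℂ (E × ℂ) _ (@instTopologicalSpaceProd E ℂ (cInftyTopology E) _)
      fun z => (t, z) :=
    @Continuous.prodMk E ℂ ℂ (cInftyTopology E) _ _ _ _
      (@continuous_const ℂ E _ (cInftyTopology E) t) continuous_id
  exact @IsOpen.preimage ℂ (E × ℂ) _ (@instTopologicalSpaceProd E ℂ (cInftyTopology E) _) _ h _ hR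

end Convenient

end

end NormalFamily

end

theorem mainTheorem2 {H : Type*} [NormedAddCommGroup H] [InnerProductSpace ℂ H]
    [CompleteSpace H] (V : Submodule ℂ H) (hV : Dense (V : Set H)) :
    -- finite dimensional parameter spaces, all classes
    (∀ (E : Type*) [NormedAddCommGroup E] [NormedSpace ℝ E] [FiniteDimensional ℝ E]
      (T : Set E) (_ : IsOpen T)
      (κ : NormalFamily.DiffClass) (_ : κ.Admissible)
      (A : E → V →ₗ[ℂ] H) (_ : ∀ t ∈ T, NormalFamily.IsNormalOp (A t))
      (_ : ∀ (u : V) (v : H), κ.IsOn (fun t => inner ℂ v (A t u)) T),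
      -- the resolvent is the bounded inverse of `A t - z` and it is of class `κ`
      (∀ p ∈ NormalFamily.globalResolventSet T A,
        NormalFamily.IsResolventAt (A p.1) p.2 (NormalFamily.resolventOp (A p.1) p.2)) ∧
      κ.IsOn (fun p : E × ℂ => NormalFamily.resolventOp (A p.1) p.2)
        (NormalFamily.globalResolventSet T A) ∧
      -- the global resolvent set is open, and connected if the resolvents are compact
      IsOpen (NormalFamily.globalResolventSet T A) ∧
      (IsConnected T → (∀ t ∈ T, NormalFamily.HasCompactResolvent (A t)) →
        IsConnected (NormalFamily.globalResolventSet T A)) ∧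
      -- the graph norms are equivalent, locally uniformly
      (∀ s ∈ T, ∀ t₀ ∈ T, ∃ U : Set E, IsOpen U ∧ t₀ ∈ U ∧ U ⊆ T ∧ ∃ C > 0, ∀ t ∈ U, ∀ u : V,
        NormalFamily.graphNorm (A t) u ≤ C * NormalFamily.graphNorm (A s) u ∧
        NormalFamily.graphNorm (A s) u ≤ C * NormalFamily.graphNorm (A t) u) ∧
      -- `A` is of class `κ` into the bounded operators from `V` to `H`
      (∀ s ∈ T, ∃ A' : E → NormalFamily.GraphSpace (A s) →L[ℂ] H,
        (∀ t ∈ T, ∀ u : V, A' t (NormalFamily.GraphSpace.of (A s) u) = A t u) ∧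
        κ.IsOn A' T)) ∧
    -- convenient parameter spaces, smooth and Hölder classes
    (∀ (E : Type*) [AddCommGroup E] [Module ℝ E] [TopologicalSpace E] [IsTopologicalAddGroup E]
      [ContinuousSMul ℝ E] [LocallyConvexSpace ℝ E] [T2Space E]
      (_ : NormalFamily.IsMackeyComplete E)
      (T : Set E) (_ : IsOpen[NormalFamily.cInftyTopology E] T)
      (κ : NormalFamily.DiffClass) (_ : κ.Admissible)
      (_ : κ = .smooth ∨ ∃ α, κ = .holder α)
      (A : E → V →ₗ[ℂ] H) (_ : ∀ t ∈ T, NormalFamily.IsNormalOp (A t))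
      (_ : ∀ (u : V) (v : H), κ.IsAlongCurves (fun t => inner ℂ v (A t u)) T),
      (∀ p ∈ NormalFamily.globalResolventSet T A,
        NormalFamily.IsResolventAt (A p.1) p.2 (NormalFamily.resolventOp (A p.1) p.2)) ∧
      κ.IsAlongCurves (fun p : E × ℂ => NormalFamily.resolventOp (A p.1) p.2)
        (NormalFamily.globalResolventSet T A) ∧
      -- open for the `c^∞`-topology of `E × ℂ`, and for the product of the `c^∞`-topologies
      IsOpen[NormalFamily.cInftyTopology (E × ℂ)] (NormalFamily.globalResolventSet T A) ∧
      IsOpen[@instTopologicalSpaceProd E ℂ (NormalFamily.cInftyTopology E) inferInstance]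
        (NormalFamily.globalResolventSet T A) ∧
      (@IsConnected E (NormalFamily.cInftyTopology E) T →
        (∀ t ∈ T, NormalFamily.HasCompactResolvent (A t)) →
        @IsConnected (E × ℂ) (NormalFamily.cInftyTopology (E × ℂ))
          (NormalFamily.globalResolventSet T A)) ∧
      (∀ s ∈ T, ∀ t₀ ∈ T, ∃ U : Set E, IsOpen[NormalFamily.cInftyTopology E] U ∧
        t₀ ∈ U ∧ U ⊆ T ∧ ∃ C > 0, ∀ t ∈ U, ∀ u : V,
        NormalFamily.graphNorm (A t) u ≤ C * NormalFamily.graphNorm (A s) u ∧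
        NormalFamily.graphNorm (A s) u ≤ C * NormalFamily.graphNorm (A t) u) ∧
      (∀ s ∈ T, ∃ A' : E → NormalFamily.GraphSpace (A s) →L[ℂ] H,
        (∀ t ∈ T, ∀ u : V, A' t (NormalFamily.GraphSpace.of (A s) u) = A t u) ∧
        κ.IsAlongCurves A' T)) := by
  refine ⟨fun E _ _ _ T hT κ hκ A hN hw => ?_, fun E _ _ _ _ _ _ _ _ T hT κ hκ hκ' A hN hw => ?_⟩
  · have hA := fun t ht => (hN t ht).closed
    have hcont := NormalFamily.continuousOn_toCLM hκ hT hA hw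
    exact ⟨fun p hp => NormalFamily.isResolventAt_resolventOp (hA _ hp.1) hp.2,
      NormalFamily.isOn_resolventOp hκ hT hA hw,
      NormalFamily.isOpen_globalResolventSet hT hA hcont,
      NormalFamily.isConnected_globalResolventSet hκ hT hA hw,
      NormalFamily.exists_graphNorm_equiv hT hA hcont,
      fun s hs => ⟨fun t => NormalFamily.GraphSpace.toCLM (A s) (A t),
        fun t ht => NormalFamily.GraphSpace.toCLM_apply (hA s hs) (hA t ht),
        NormalFamily.isOn_toCLM hκ hT hA hw (hA s hs)⟩⟩
  · have hA := fun t ht => (hN t ht).closed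
    have hR := NormalFamily.isOpen_prod_globalResolventSet hκ hT hA hw
    exact ⟨fun p hp => NormalFamily.isResolventAt_resolventOp (hA _ hp.1) hp.2,
      NormalFamily.isAlongCurves_resolventOp hκ hκ' hA hw,
      NormalFamily.isOpen_cInfty_prod hR, hR,
      NormalFamily.isConnected_cInfty_globalResolventSet hκ hT hA hw,
      @NormalFamily.exists_graphNorm_equiv H _ _ V E (NormalFamily.cInftyTopology E) T A _ hT hA
        (NormalFamily.continuousOn_cInfty_toCLM hκ hT hA hw),
      fun s hs => ⟨fun t => NormalFamily.GraphSpace.toCLM (A s) (A t),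
        fun t ht => NormalFamily.GraphSpace.toCLM_apply (hA s hs) (hA t ht),
        NormalFamily.isAlongCurves_toCLM hκ hA hw (hA s hs)⟩⟩
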